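/- All graphs are finite and simple. For a graph $G$ let $\Delta(G)$ be its maximum degree and $\chi'(G)$ its chromatic index, i.e. the least number of colors in an edge-coloring in which no two distinct edges sharing an endpoint receive the same color. $G$ is of Class 1 if $\chi'(G)=\Delta(G)$ and of Class 2 otherwise; it is overfull if $|E(G)|>\Delta(G)\lfloor |V(G)|/2\rfloor$. An edge $e$ of $G$ is critical if $\chi'(G-e)<\chi'(G)$. $G$ is $\Delta$-critical if $\Delta(G)=\Delta$, $\chi'(G)=\Delta+1$, and $\chi'(H)<\chi'(G)$ for every proper subgraph $H$ of $G$. A graph is obtained from a graph $G_0$ by a vertex-splitting if, for some vertex $v$ of $G_0$ and some partition of the neighborhood $N_{G_0}(v)$ into two nonempty sets $N_1,N_2$, it arises by replacing $v$ with two new adjacent vertices $v_1,v_2$, where the neighbors of $v_i$ among the old vertices are exactly the members of $N_i$. **Theorem.** Let $n$ and $\Delta$ be positive integers with $\Delta\ge\frac{2n-4}{3}$. If an $n$-vertex graph $G$ is obtained by a vertex-splitting from an $(n-1)$-vertex connected $\Delta$-regular Class 1 graph, then $G$ is overfull, $G$ is of Class 2, every edge of $G$ is critical, and $G$ is $\Delta$-critical.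 (In terms of the order $m=n-1$ of the original graph, the hypothesis reads $\Delta\ge\frac{2m-2}{3}$.) -/

import Mathlib

namespace VertexSplitting

open SimpleGraph

/-- The chromatic index: the least number of colors in a proper edge-coloring, i.e. a coloring of
the edges in which distinct edges that share an endpoint get distinct colors. -/
noncomputable def chromaticIndex {V : Type*} (G : SimpleGraph V) : ℕ∞ :=
  G.lineGraph.chromaticNumber

/-- `G` is of Class 1 if its chromatic index equals its maximum degree. -/
def IsClassOne {V : Type*} [Fintype V] (G : SimpleGraph V) [DecidableRel G.Adj] : Prop :=
  chromaticIndex G = (G.maxDegree : ℕ∞)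

/-- `G` is of Class 2 if it is not of Class 1. -/
def IsClassTwo {V : Type*} [Fintype V] (G : SimpleGraph V) [DecidableRel G.Adj] : Prop :=
  ¬ IsClassOne G

/-- `G` is overfull if `|E(G)| > Δ(G) ⌊|V(G)| / 2⌋`. -/
def IsOverfull {V : Type*} [Fintype V] (G : SimpleGraph V) [DecidableRel G.Adj] : Prop :=
  G.maxDegree * (Fintype.card V / 2) < G.edgeFinset.card

/-- The edge `e` is critical if deleting it decreases the chromatic index. -/
def IsCriticalEdge {V : Type*} (G : SimpleGraph V) (e : Sym2 V) : Prop :=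
  e ∈ G.edgeSet ∧ chromaticIndex (G.deleteEdges {e}) < chromaticIndex G

/-- `G` is edge-chromatic critical if every proper subgraph (on any set of vertices) has smaller
chromatic index. -/
def IsEdgeChromaticCritical {V : Type*} (G : SimpleGraph V) : Prop :=
  ∀ H : G.Subgraph, H ≠ ⊤ → chromaticIndex H.coe < chromaticIndex G

/-- `G` is `Δ`-critical if `Δ` is its maximum degree, it is edge-chromatic critical, and its
chromatic index is `Δ + 1`. -/
def IsDeltaCritical {V : Type*} [Fintype V] (G : SimpleGraph V) [DecidableRel G.Adj]
    (Δ : ℕ) : Prop :=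
  G.maxDegree = Δ ∧ IsEdgeChromaticCritical G ∧ chromaticIndex G = (Δ : ℕ∞) + 1

/-- The adjacency relation after replacing `v` by two adjacent vertices
`v₁ = Sum.inr false`, `v₂ = Sum.inr true`, whose neighbors among the old vertices are
the members of `N₁` and `N₂` respectively. -/
def splitAdj {W : Type*} (G : SimpleGraph W) (v : W) (N₁ N₂ : Set W) :
    {w : W // w ≠ v} ⊕ Bool → {w : W // w ≠ v} ⊕ Bool → Prop
  | Sum.inl x, Sum.inl y => G.Adj x y
  | Sum.inl x, Sum.inr false => (x : W) ∈ N₁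
  | Sum.inl x, Sum.inr true => (x : W) ∈ N₂
  | Sum.inr false, Sum.inl y => (y : W) ∈ N₁
  | Sum.inr true, Sum.inl y => (y : W) ∈ N₂
  | Sum.inr i, Sum.inr j => i ≠ j

/-- The graph obtained from `G` by replacing `v` by two adjacent vertices with old neighbors
`N₁` and `N₂`. -/
def splitGraph {W : Type*} (G : SimpleGraph W) (v : W) (N₁ N₂ : Set W) :
    SimpleGraph ({w : W // w ≠ v} ⊕ Bool) where
  Adj := splitAdj G v N₁ N₂
  symm := ⟨by
    rintro (x | (_ | _)) (y | (_ | _)) h <;> simp_all [splitAdj, G.adj_comm]⟩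
  loopless := ⟨by
    rintro (x | (_ | _)) h <;> simp_all [splitAdj]⟩

/-- `G` is (up to isomorphism) obtained from `G₀` by a vertex-splitting: for some vertex `v` and
some partition of the neighborhood of `v` into two nonempty sets, `G` is the split graph. -/
def IsVertexSplitting {W V : Type*} (G₀ : SimpleGraph W) (G : SimpleGraph V) : Prop :=
  ∃ (v : W) (N₁ N₂ : Set W), N₁.Nonempty ∧ N₂.Nonempty ∧ Disjoint N₁ N₂ ∧
    N₁ ∪ N₂ = G₀.neighborSet v ∧ Nonempty (G ≃g splitGraph G₀ v N₁ N₂)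

end VertexSplitting

/-! Let m = n - 1. In a Δ-edge-coloring of the regular graph `G₀` every color class is a perfect
matching, so m is even. Splitting adds one vertex and one edge, so the split graph has Δm/2 + 1
edges while ⌊n/2⌋ = m/2. It is overfull by exactly one edge and not Δ-colorable; a fresh color on
the new edge gives a coloring with Δ + 1 colors. Everything else follows once the split graph minus
any one edge is shown to be Δ-colorable.

If the missing edge meets a half of `v`, the old colors work, and the color of a missing old edge
goes on the new edge. Otherwise the missing edge is an edge `wz` of `G₀ - v`. It then suffices to
recolor so that, at `v`, one edge trades its color for one already used on the other side of the
partition: both halves stay proper and the lost color goes on the new edge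
(`HasSplitColoring.of_row`). Cutting `wz` into two half-edges gives the freedom to do this by Kempe
changes on chains ending in half-edges (`IsPole.exists_kempe_pairing`).

Three cases cover all edges `wz`. If `w` or `z` is a neighbor of `v`, `hasSplitColoring_of_mem_left`
applies. If both sides of the partition have at least two elements, a common neighbor of `v` and `w`
serves as an intermediary (`hasSplitColoring_of_nontrivial`). If one side is a single vertex `s`,
splitting means subdividing `vs`; the degree bound supplies a common neighbor `x ≠ s` of `v`, `w`
and `z`. Deleting `x` and cutting `vs` and `wz` leaves eight relevant half-edges, and a finite
analysis of Kempe changes on their four colors finishes (`exists_isGoodBoundary`,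
`hasSplitColoring_of_triangle`). -/

namespace VertexSplitting

open Function

/-! ### Kempe chains on half-edges, as orbits of a dihedral action -/

section Kempe

variable {D I C : Type*}

/-- A full coloring of a system of half-edges: `src` sends a half-edge to the vertex carrying it,
`σ` exchanges the two halves of an edge and fixes the half-edges that belong to no edge.  Every
vertex sees every color exactly once. -/
def IsFullColoring (src : D → I) (σ : Equiv.Perm D) (f : D → C) : Prop :=
  (∀ d, f (σ d) = f d) ∧ ∀ u c, (∃ d, src d = u) → ∃! d, src d = u ∧ f d = c

variable {src : D → I} {σ : Equiv.Perm D} {f : D → C}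

/-- For an involution `e` of the colors, the half-edges have an involution that preserves the
carrying vertex and changes the color by `e`. -/
theorem IsFullColoring.exists_turn (hf : IsFullColoring src σ f) {e : C → C} (he : Involutive e) :
    ∃ τ : Equiv.Perm D, (∀ d, τ (τ d) = d) ∧ (∀ d, src (τ d) = src d) ∧ ∀ d, f (τ d) = e (f d) := by
  choose t ht using fun d => (hf.2 (src d) (e (f d)) ⟨d, rfl⟩).exists
  have htt : Involutive t := fun d => by
    refine (hf.2 (src d) (f d) ⟨d, rfl⟩).unique ⟨?_, ?_⟩ ⟨rfl, rfl⟩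
    · rw [(ht _).1, (ht _).1]
    · rw [(ht _).2, (ht _).2, he]
  exact ⟨htt.toPerm, htt, fun d => (ht d).1, fun d => (ht d).2⟩

theorem minimalPeriod_zpow_apply [Finite D] (θ : Equiv.Perm D) (d : D) (n : ℤ) :
    (θ ^ n) d = d ↔ (minimalPeriod θ d : ℤ) ∣ n :=
  MulAction.zpow_smul_eq_iff_minimalPeriod_dvd (a := θ) (b := d) (n := n)

/-- Kempe changes: the half-edges fixed by `σ` whose color is moved by `e` come in pairs, and any
union of pairs can be recolored by `e` without affecting the other fixed half-edges. -/
theorem IsFullColoring.exists_kempe_pairing [Finite D] (hσ : ∀ d, σ (σ d) = d)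
    (hf : IsFullColoring src σ f) {e : C → C} (he : Involutive e) :
    ∃ π : D → D,
      (∀ l, σ l = l → e (f l) ≠ f l → σ (π l) = π l ∧ π l ≠ l ∧ π (π l) = l ∧
        (f (π l) = f l ∨ f (π l) = e (f l))) ∧
      ∀ S : Set D, (∀ l ∈ S, π l ∈ S) → ∃ f' : D → C, IsFullColoring src σ f' ∧
        (∀ d, f' d = f d ∨ f' d = e (f d)) ∧
        ∀ l, σ l = l → (l ∈ S → f' l = e (f l)) ∧ (l ∉ S → f' l = f l) := by
  classical
  obtain ⟨τ, hτ, hτs, hτf⟩ := hf.exists_turn he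
  -- One step along a chain: turn at the vertex with `τ`, then cross the edge with `σ`. Both
  -- involutions invert `θ`, so from a fixed point `l` of `σ` they act on the exponents of `θ` as n
  -- ↦ -n and n ↦ -(n + 1).
  set θ : Equiv.Perm D := σ * τ with hθ
  have hσinv : σ⁻¹ = σ := by ext d; rw [Equiv.Perm.inv_eq_iff_eq, hσ]
  have hτinv : τ⁻¹ = τ := by ext d; rw [Equiv.Perm.inv_eq_iff_eq, hτ]
  have hconj : ∀ n : ℤ, σ * θ ^ n = θ ^ (-n) * σ := by
    intro n
    have h1 : σ * θ * σ⁻¹ = θ⁻¹ := by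
      rw [hθ, mul_inv_rev, hτinv, hσinv]
      ext d; simp [hσ]
    have h2 : σ * θ ^ n * σ⁻¹ = θ ^ (-n) := by
      rw [← conj_zpow, h1, inv_zpow, zpow_neg]
    rw [← h2]; group
  have hσθ : ∀ l, σ l = l → ∀ n : ℤ, σ ((θ ^ n) l) = (θ ^ (-n)) l := by
    intro l hl n
    have := congrArg (fun g : Equiv.Perm D => g l) (hconj n)
    simpa [hl] using this
  have hτθ : ∀ l, σ l = l → ∀ n : ℤ, τ ((θ ^ n) l) = (θ ^ (-(n + 1))) l := by
    intro l hl n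
    rw [← hσθ l hl, add_comm, zpow_add, zpow_one]
    simp [hθ, hσ]
  have hfθ : ∀ d, f (θ d) = e (f d) := fun d => by
    rw [hθ, Equiv.Perm.mul_apply, hf.1, hτf]
  have hfθn : ∀ (n : ℕ) d, f ((θ ^ n) d) = f d ∨ f ((θ ^ n) d) = e (f d) := by
    intro n d
    induction n with
    | zero => simp
    | succ k ih =>
      rw [pow_succ', Equiv.Perm.mul_apply, hfθ]
      rcases ih with h | h <;> rw [h]
      · exact Or.inr rfl
      · exact Or.inl (he _)
  let N : D → ℕ := fun d => minimalPeriod θ d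
  -- Modulo an even period N the reflection n ↦ -n fixes exactly 0 and N/2, so the other end of the
  -- chain lies half a period away.
  let π : D → D := fun d => (θ ^ (N d / 2)) d
  have hper : ∀ d (n : ℤ), (θ ^ n) d = d ↔ (N d : ℤ) ∣ n := minimalPeriod_zpow_apply θ
  have heq : ∀ d (m n : ℤ), (N d : ℤ) ∣ m - n → (θ ^ m) d = (θ ^ n) d := by
    intro d m n h
    rw [← hper, sub_eq_neg_add, zpow_add, Equiv.Perm.mul_apply, zpow_neg,
      Equiv.Perm.inv_eq_iff_eq] at h
    exact h
  -- For an odd period 2k + 1, `τ` would fix the half-edge at exponent k, although `τ` changes its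
  -- color.
  have heven : ∀ l, σ l = l → e (f l) ≠ f l → N l = 2 * (N l / 2) := by
    intro l hl hne
    by_contra hodd
    have hN : N l = 2 * (N l / 2) + 1 := by omega
    have h1 := hτθ l hl (N l / 2 : ℕ)
    rw [heq l (-((N l / 2 : ℕ) + 1)) (N l / 2 : ℕ) ⟨-1, by omega⟩] at h1
    have h2 := hτf ((θ ^ ((N l / 2 : ℕ) : ℤ)) l)
    rw [h1, zpow_natCast] at h2
    rcases hfθn (N l / 2) l with h | h <;> rw [h] at h2
    · exact hne h2.symm
    · rw [he] at h2; exact hne h2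
  have hNθ : ∀ d (n : ℕ), N ((θ ^ n) d) = N d := by
    intro d n
    apply Nat.dvd_antisymm <;> rw [← Int.natCast_dvd_natCast, ← hper]
    · rw [← Equiv.Perm.mul_apply, ← zpow_natCast θ n, ← zpow_add, add_comm, zpow_add,
        Equiv.Perm.mul_apply, (hper d _).2 dvd_rfl]
    · have h := (hper ((θ ^ n) d) _).2 dvd_rfl
      rw [← Equiv.Perm.mul_apply, ← zpow_natCast θ n, ← zpow_add, add_comm, zpow_add,
        Equiv.Perm.mul_apply] at h
      exact (θ ^ (n : ℤ)).injective h
  refine ⟨π, fun l hl hne => ⟨?_, ?_, ?_, hfθn _ _⟩, ?_⟩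
  · have h := hσθ l hl (N l / 2 : ℕ)
    rw [heq l (-(N l / 2 : ℕ)) (N l / 2 : ℕ) ⟨-1, by have := heven l hl hne; omega⟩,
      zpow_natCast] at h
    exact h
  · intro h
    have h' : (θ ^ ((N l / 2 : ℕ) : ℤ)) l = l := by rw [zpow_natCast]; exact h
    rw [hper, Int.natCast_dvd_natCast] at h'
    have hpos : 0 < N l := minimalPeriod_pos_of_mem_periodicPts (θ.injective.mem_periodicPts l)
    have := heven l hl hne
    have := Nat.le_of_dvd (by omega) h'
    omega
  · change (θ ^ (N ((θ ^ (N l / 2)) l) / 2)) ((θ ^ (N l / 2)) l) = l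
    rw [hNθ, ← Equiv.Perm.mul_apply, ← pow_add, ← zpow_natCast, hper, Int.natCast_dvd_natCast]
    exact ⟨1, by have := heven l hl hne; omega⟩
  · intro S hS
    -- The union of the chains ending in `S` is stable under `σ` and `τ`. Hence recoloring it treats
    -- both halves of an edge alike and permutes colors at each vertex.
    let O : Set D := {d | ∃ l ∈ S, σ l = l ∧ ∃ n : ℤ, (θ ^ n) l = d}
    have hOσ : ∀ d, d ∈ O → σ d ∈ O := by
      rintro _ ⟨l, hlS, hl, n, rfl⟩
      exact ⟨l, hlS, hl, -n, (hσθ l hl n).symm⟩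
    have hOτ : ∀ d, d ∈ O → τ d ∈ O := by
      rintro _ ⟨l, hlS, hl, n, rfl⟩
      exact ⟨l, hlS, hl, -(n + 1), (hτθ l hl n).symm⟩
    refine ⟨fun d => if d ∈ O then e (f d) else f d, ⟨?_, ?_⟩, ?_, ?_⟩
    · intro d
      by_cases h : d ∈ O
      · simp only [h, hOσ d h, if_true, hf.1]
      · have h' : σ d ∉ O := fun h' => h (by simpa [hσ] using hOσ _ h')
        simp only [h, h', if_false, hf.1]
    · intro u c hu
      obtain ⟨d, ⟨hd, hdc⟩, huniq⟩ := hf.2 u c hu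
      have key : ∀ d', src d' = u → (if d' ∈ O then e (f d') else f d') = c →
          d' = if d ∈ O then τ d else d := by
        intro d' hd' hc
        by_cases h : d' ∈ O
        · rw [if_pos h] at hc
          have : τ d' = d := huniq _ ⟨(hτs d').trans hd', (hτf d').trans hc⟩
          rw [← this, if_pos (hOτ _ h), hτ]
        · rw [if_neg h] at hc
          have := huniq _ ⟨hd', hc⟩
          subst this
          rw [if_neg h]
      refine ⟨if d ∈ O then τ d else d, ⟨?_, ?_⟩, fun d' h => key d' h.1 h.2⟩
      · split_ifs
        · rw [hτs, hd]
        · exact hd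
      · by_cases h : d ∈ O
        · simp only [h, hOτ d h, if_true, hτf, hdc, he c]
        · simp only [h, if_false, hdc]
    · intro d
      by_cases h : d ∈ O <;> simp [h]
    · intro l hl
      refine ⟨fun h => if_pos ⟨l, h, hl, 0, by simp⟩, fun h => if_neg ?_⟩
      rintro ⟨l₀, hl₀S, hl₀, n, rfl⟩
      apply h
      have h1 := hσθ l₀ hl₀ n
      rw [hl] at h1
      -- A fixed half-edge at exponent n satisfies -n ≡ n modulo the period, so it is `l₀` itself or
      -- `π l₀`.
      have h2 : (N l₀ : ℤ) ∣ 2 * n := by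
        rw [← hper, two_mul, zpow_add, Equiv.Perm.mul_apply, h1, ← Equiv.Perm.mul_apply,
          ← zpow_add]
        simp
      obtain ⟨k, hk⟩ := h2
      have hcase : (N l₀ : ℤ) ∣ n ∨ (N l₀ : ℤ) ∣ n - (N l₀ / 2 : ℕ) := by
        rcases Int.even_or_odd' k with ⟨j, hj | hj⟩
        · left; refine ⟨j, ?_⟩; subst hj; linarith
        · rcases Nat.even_or_odd' (N l₀) with ⟨r, hr | hr⟩
          · right
            refine ⟨j, ?_⟩
            have : N l₀ / 2 = r := by omega
            rw [this]
            subst hj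
            rw [hr] at hk ⊢
            push_cast at hk ⊢
            linarith
          · exfalso
            have h3 : Odd ((N l₀ : ℤ) * k) := by
              apply Odd.mul
              · rw [hr]; exact ⟨r, by push_cast; ring⟩
              · exact ⟨j, hj⟩
            rw [← hk] at h3
            exact (Int.not_even_iff_odd.2 h3) (even_two_mul n)
      rcases hcase with h3 | h3
      · rw [(hper _ _).2 h3]; exact hl₀S
      · rw [heq _ _ _ h3, zpow_natCast]; exact hS _ hl₀S

end Kempe

/-! ### Colorings of graphs with deleted vertices and cut edges -/

section Pole

variable {W C : Type*} {G : SimpleGraph W}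

/-- `h` colors the edges at `u` bijectively. -/
def IsRow (G : SimpleGraph W) (u : W) (h : W → C) : Prop :=
  ∀ c, ∃! y, G.Adj u y ∧ h y = c

theorem IsRow.eq_of_eq {u : W} {h : W → C} (hh : IsRow G u h) {y y' : W} (hy : G.Adj u y)
    (hy' : G.Adj u y') (heq : h y = h y') : y = y' :=
  (hh (h y')).unique ⟨hy, heq⟩ ⟨hy', rfl⟩

theorem IsRow.congr {u : W} {h h' : W → C} (hh : IsRow G u h)
    (heq : ∀ y, G.Adj u y → h' y = h y) : IsRow G u h' := by
  intro c
  obtain ⟨y, ⟨hy, hc⟩, huniq⟩ := hh c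
  exact ⟨y, ⟨hy, (heq y hy).trans hc⟩, fun y' hy' => huniq y' ⟨hy'.1, (heq y' hy'.1) ▸ hy'.2⟩⟩

theorem adj_swap [DecidableEq W] {u y₁ y₂ : W} (h₁ : G.Adj u y₁) (h₂ : G.Adj u y₂) {y : W}
    (hy : G.Adj u y) : G.Adj u (Equiv.swap y₁ y₂ y) := by
  rw [Equiv.swap_apply_def]
  split_ifs <;> assumption

theorem IsRow.comp_swap [DecidableEq W] {u : W} {h : W → C} (hh : IsRow G u h) {y₁ y₂ : W}
    (h₁ : G.Adj u y₁) (h₂ : G.Adj u y₂) : IsRow G u (fun y => h (Equiv.swap y₁ y₂ y)) := by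
  intro c
  obtain ⟨y, ⟨hy, hc⟩, huniq⟩ := hh c
  refine ⟨Equiv.swap y₁ y₂ y, ⟨adj_swap h₁ h₂ hy, by simpa using hc⟩, fun y' hy' => ?_⟩
  rw [← huniq _ ⟨adj_swap h₁ h₂ hy'.1, hy'.2⟩, Equiv.swap_apply_self]

/-- A coloring by `C` of the graph `G` with the vertices of `R` deleted and the edges of `K` cut
into two half-edges, in which every remaining vertex sees every color exactly once.  The color of
the half-edge at `u` pointing to `y` is `f u y`. -/
def IsPole (G : SimpleGraph W) (R : Set W) (K : Set (Sym2 W)) (f : W → W → C) : Prop :=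
  (∀ u, u ∉ R → IsRow G u (f u)) ∧
    ∀ u y, G.Adj u y → u ∉ R → y ∉ R → s(u, y) ∉ K → f u y = f y u

/-- The half-edges that are not part of a whole edge. -/
def IsTerminal (G : SimpleGraph W) (R : Set W) (K : Set (Sym2 W)) (l : W × W) : Prop :=
  G.Adj l.1 l.2 ∧ l.1 ∉ R ∧ (l.2 ∈ R ∨ s(l.1, l.2) ∈ K)

variable {R : Set W} {K : Set (Sym2 W)} {f : W → W → C}

theorem IsPole.mono (hf : IsPole G R K f) {R' : Set W} {K' : Set (Sym2 W)} (hR : R ⊆ R')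
    (hK : ∀ u y, s(u, y) ∈ K → s(u, y) ∈ K' ∨ u ∈ R' ∨ y ∈ R') : IsPole G R' K' f :=
  ⟨fun u hu => hf.1 u fun h => hu (hR h), fun u y huy hu hy hK' =>
    hf.2 u y huy (fun h => hu (hR h)) (fun h => hy (hR h)) fun h => by
      rcases hK u y h with h | h | h
      exacts [hK' h, hu h, hy h]⟩

theorem IsPole.glue (hf : IsPole G R K f)
    (h : ∀ u y, s(u, y) ∈ K → f u y = f y u) : IsPole G R ∅ f :=
  ⟨hf.1, fun u y huy hu hy _ => by
    by_cases hK : s(u, y) ∈ K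
    · exact h u y hK
    · exact hf.2 u y huy hu hy hK⟩

open Classical in
/-- A deleted vertex can be put back if a bijective row fits. -/
theorem IsPole.restore {x : W} (hf : IsPole G (insert x R) K f) {h : W → C} (hh : IsRow G x h)
    (hfit : ∀ y, G.Adj x y → y ∉ R → s(x, y) ∉ K → h y = f y x) :
    IsPole G R K (fun u y => if u = x then h y else f u y) := by
  refine ⟨fun u hu => ?_, fun u y huy hu hy hK => ?_⟩
  · by_cases hux : u = x
    · subst hux; simpa using hh
    · simpa [hux] using hf.1 u (by simp [hux, hu])
  · by_cases hux : u = x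
    · subst hux
      simp [huy.ne', hfit y huy hy hK]
    · by_cases hyx : y = x
      · subst hyx
        simp [hux, hfit u huy.symm hu (by rwa [Sym2.eq_swap])]
      · simpa [hux, hyx] using hf.2 u y huy (by simp [hux, hu]) (by simp [hyx, hy]) hK

open Classical in
/-- Two terminals at the same vertex can exchange their colors. -/
theorem IsPole.exchange (hf : IsPole G R K f) {u y₁ y₂ : W} (h₁ : IsTerminal G R K (u, y₁))
    (h₂ : IsTerminal G R K (u, y₂)) :
    IsPole G R K (fun a b => if a = u then f u (Equiv.swap y₁ y₂ b) else f a b) := by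
  have key : ∀ b, G.Adj u b → b ∉ R → s(u, b) ∉ K → f u (Equiv.swap y₁ y₂ b) = f b u := by
    intro b hub hb hK
    rw [Equiv.swap_apply_of_ne_of_ne]
    · exact hf.2 u b hub h₁.2.1 hb hK
    · rintro rfl; exact h₁.2.2.elim hb hK
    · rintro rfl; exact h₂.2.2.elim hb hK
  refine ⟨fun a ha => ?_, fun a b hab ha hb hK => ?_⟩
  · by_cases hau : a = u
    · subst hau; simpa using (hf.1 a ha).comp_swap h₁.1 h₂.1
    · simpa [hau] using hf.1 a ha
  · by_cases hau : a = u
    · subst hau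
      simp [hab.ne', key b hab hb hK]
    · by_cases hbu : b = u
      · subst hbu
        simp [hau, key a hab.symm ha (by rwa [Sym2.eq_swap])]
      · simpa [hau, hbu] using hf.2 a b hab ha hb hK

/-- Kempe changes in a pole: for an involution `e` of the colors the terminals with color moved by
`e` come in pairs, and any union of pairs can be recolored by `e`. -/
theorem IsPole.exists_kempe_pairing [Finite W] (hf : IsPole G R K f) {e : C → C}
    (he : Involutive e) :
    ∃ π : W × W → W × W,
      (∀ l, IsTerminal G R K l → e (f l.1 l.2) ≠ f l.1 l.2 → IsTerminal G R K (π l) ∧ π l ≠ l ∧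
        π (π l) = l ∧ (f (π l).1 (π l).2 = f l.1 l.2 ∨ f (π l).1 (π l).2 = e (f l.1 l.2))) ∧
      ∀ S : Set (W × W), (∀ l ∈ S, π l ∈ S) → ∃ f' : W → W → C, IsPole G R K f' ∧
        (∀ u y, f' u y = f u y ∨ f' u y = e (f u y)) ∧
        ∀ l, IsTerminal G R K l →
          (l ∈ S → f' l.1 l.2 = e (f l.1 l.2)) ∧ (l ∉ S → f' l.1 l.2 = f l.1 l.2) := by
  classical
  -- The half-edges are the darts at remaining vertices. `mate` reverses a dart unless it is a
  -- terminal, so the terminals are exactly its fixed points.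
  let D := {l : W × W // G.Adj l.1 l.2 ∧ l.1 ∉ R}
  let mate : D → D := fun d => if h : IsTerminal G R K d.1 then d else
    ⟨d.1.swap, d.2.1.symm, fun h' => h ⟨d.2.1, d.2.2, Or.inl h'⟩⟩
  have hmate_pos : ∀ d : D, IsTerminal G R K d.1 → mate d = d := fun d h => dif_pos h
  have hmate_neg : ∀ d : D, ¬ IsTerminal G R K d.1 → (mate d).1 = d.1.swap := fun d h => by
    simp [mate, h]
  have hinv : Involutive mate := by
    intro d
    by_cases h : IsTerminal G R K d.1
    · rw [hmate_pos d h, hmate_pos d h]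
    · have h' : ¬ IsTerminal G R K (mate d).1 := by
        rw [hmate_neg d h]
        rintro ⟨-, -, h₂ | h₂⟩
        · exact d.2.2 h₂
        · exact h ⟨d.2.1, d.2.2, Or.inr (by rwa [Sym2.eq_swap])⟩
      apply Subtype.ext
      rw [hmate_neg _ h', hmate_neg d h, Prod.swap_swap]
  have hfix : ∀ d : D, (hinv.toPerm mate) d = d ↔ IsTerminal G R K d.1 := by
    intro d
    refine ⟨fun h => ?_, fun h => hmate_pos d h⟩
    by_contra hn
    have h1 : (mate d).1 = d.1 := congrArg Subtype.val h
    rw [hmate_neg d hn] at h1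
    exact d.2.1.ne (congrArg Prod.snd h1)
  let F : D → C := fun d => f d.1.1 d.1.2
  let src : D → W := fun d => d.1.1
  have hfull : IsFullColoring src (hinv.toPerm mate) F := by
    refine ⟨fun d => ?_, ?_⟩
    · by_cases h : IsTerminal G R K d.1
      · rw [(hfix d).2 h]
      · have h2 : d.1.2 ∉ R := fun h' => h ⟨d.2.1, d.2.2, Or.inl h'⟩
        have h3 : s(d.1.1, d.1.2) ∉ K := fun h' => h ⟨d.2.1, d.2.2, Or.inr h'⟩
        change f (mate d).1.1 (mate d).1.2 = _
        rw [hmate_neg d h]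
        exact (hf.2 _ _ d.2.1 d.2.2 h2 h3).symm
    · rintro _ c ⟨d, rfl⟩
      obtain ⟨y, ⟨hy, hc⟩, huniq⟩ := hf.1 d.1.1 d.2.2 c
      refine ⟨⟨(d.1.1, y), hy, d.2.2⟩, ⟨rfl, hc⟩, ?_⟩
      rintro ⟨⟨a, b⟩, hab, ha⟩ ⟨h1, h2⟩
      obtain rfl : a = d.1.1 := h1
      obtain rfl : b = y := huniq b ⟨hab, h2⟩
      rfl
  obtain ⟨π, hπ, hS⟩ := IsFullColoring.exists_kempe_pairing
    (σ := hinv.toPerm mate) (fun d => hinv d) hfull he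
  let π' : W × W → W × W := fun l => if h : G.Adj l.1 l.2 ∧ l.1 ∉ R then (π ⟨l, h⟩).1 else l
  have hπ' : ∀ d : D, π' d.1 = (π d).1 := fun d => dif_pos d.2
  refine ⟨π', fun l hl hne => ?_, fun S hSπ => ?_⟩
  · obtain ⟨h1, h2, h3, h4⟩ := hπ ⟨l, hl.1, hl.2.1⟩ ((hfix _).2 hl) hne
    have h0 := hπ' ⟨l, hl.1, hl.2.1⟩
    dsimp only at h0
    rw [h0, hπ', h3]
    exact ⟨(hfix _).1 h1, fun h => h2 (Subtype.ext h), rfl, h4⟩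
  · obtain ⟨F', hF', h1, h2⟩ := hS {d | d.1 ∈ S} fun d hd => by
      change (π d).1 ∈ S
      rw [← hπ']
      exact hSπ _ hd
    have hval : ∀ d : D, (if h : G.Adj d.1.1 d.1.2 ∧ d.1.1 ∉ R then F' ⟨(d.1.1, d.1.2), h⟩
        else f d.1.1 d.1.2) = F' d := fun d => dif_pos d.2
    refine ⟨fun u y => if h : G.Adj u y ∧ u ∉ R then F' ⟨(u, y), h⟩ else f u y, ⟨?_, ?_⟩, ?_, ?_⟩
    · intro u hu c
      obtain ⟨y₀, ⟨hy₀, -⟩, -⟩ := hf.1 u hu c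
      obtain ⟨d, ⟨hd1, hd2⟩, huniq⟩ := hF'.2 u c ⟨⟨(u, y₀), hy₀, hu⟩, rfl⟩
      obtain rfl : d.1.1 = u := hd1
      refine ⟨d.1.2, ⟨d.2.1, (hval d).trans hd2⟩, ?_⟩
      rintro y ⟨hy, hc⟩
      have h3 := huniq ⟨(d.1.1, y), hy, hu⟩ ⟨rfl, (hval ⟨(d.1.1, y), hy, hu⟩).symm.trans hc⟩
      exact congrArg (fun d : D => d.1.2) h3
    · intro u y huy hu hy hK
      have h3 := hF'.1 ⟨(u, y), huy, hu⟩
      have h4 : (hinv.toPerm mate) ⟨(u, y), huy, hu⟩ = ⟨(y, u), huy.symm, hy⟩ :=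
        Subtype.ext (hmate_neg _ fun h => h.2.2.elim hy hK)
      rw [h4] at h3
      simp only [huy, huy.symm, hu, hy, not_false_eq_true, and_self, dif_pos, h3]
    · intro u y
      by_cases h : G.Adj u y ∧ u ∉ R
      · simpa [h] using h1 ⟨(u, y), h⟩
      · simp [h]
    · intro l hl
      have h3 := h2 ⟨l, hl.1, hl.2.1⟩ ((hfix _).2 hl)
      have h4 := hval ⟨l, hl.1, hl.2.1⟩
      dsimp only at h4 ⊢
      rw [h4]
      exact h3

/-- A Kempe change along a single chain that ends in the terminal `l`. -/
theorem IsPole.exists_pair_swap [Finite W] (hf : IsPole G R K f) {e : C → C}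
    (he : Involutive e) {l : W × W} (hl : IsTerminal G R K l) (hne : e (f l.1 l.2) ≠ f l.1 l.2) :
    ∃ l', IsTerminal G R K l' ∧ l' ≠ l ∧
      (f l'.1 l'.2 = f l.1 l.2 ∨ f l'.1 l'.2 = e (f l.1 l.2)) ∧
      ∃ f' : W → W → C, IsPole G R K f' ∧ (∀ u y, f' u y = f u y ∨ f' u y = e (f u y)) ∧
        f' l.1 l.2 = e (f l.1 l.2) ∧ f' l'.1 l'.2 = e (f l'.1 l'.2) ∧
        ∀ k, IsTerminal G R K k → k ≠ l → k ≠ l' → f' k.1 k.2 = f k.1 k.2 := by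
  obtain ⟨π, hπ, hS⟩ := hf.exists_kempe_pairing he
  obtain ⟨h1, h2, h3, h4⟩ := hπ l hl hne
  obtain ⟨f', hf', h5, h6⟩ := hS {l, π l} (by
    rintro k (rfl | rfl)
    · simp
    · simp [h3])
  exact ⟨π l, h1, h2, h4, f', hf', h5, (h6 l hl).1 (by simp), (h6 _ h1).1 (by simp),
    fun k hk hkl hkl' => (h6 k hk).2 (by simp [hkl, hkl'])⟩

end Pole

/-! ### Repairing a missing edge by Kempe changes -/

section Splitting

variable {W C : Type*} {G : SimpleGraph W} {v : W} {N₁ N₂ : Set W}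

/-- A coloring of `G` with `v` deleted and the edge `wz` cut that yields a coloring of the
split graph without the edge `wz`; the color `γ` is left for the edge between the two halves
of `v`. -/
def HasSplitColoring (C : Type*) (G : SimpleGraph W) (v : W) (N₁ N₂ : Set W) (w z : W) : Prop :=
  ∃ (f : W → W → C) (γ : C), IsPole G {v} {s(w, z)} f ∧ Set.InjOn (fun y => f y v) N₁ ∧
    Set.InjOn (fun y => f y v) N₂ ∧ ∀ y, G.Adj v y → f y v ≠ γ

theorem HasSplitColoring.swap_sides {w z : W} (h : HasSplitColoring C G v N₁ N₂ w z) :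
    HasSplitColoring C G v N₂ N₁ w z := by
  obtain ⟨f, γ, h1, h2, h3, h4⟩ := h
  exact ⟨f, γ, h1, h3, h2, h4⟩

theorem HasSplitColoring.swap_ends {w z : W} (h : HasSplitColoring C G v N₁ N₂ w z) :
    HasSplitColoring C G v N₁ N₂ z w := by
  unfold HasSplitColoring at *
  rwa [Sym2.eq_swap]

/-- `x` and `y` lie on different sides of the partition. -/
def Opposite (N₁ N₂ : Set W) (x y : W) : Prop :=
  (x ∈ N₁ ∧ y ∈ N₂) ∨ (x ∈ N₂ ∧ y ∈ N₁)

theorem Opposite.symm {x y : W} (h : Opposite N₁ N₂ x y) : Opposite N₁ N₂ y x := by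
  unfold Opposite at *; tauto

theorem Opposite.ne {x y : W} (h : Opposite N₁ N₂ x y) (hd : Disjoint N₁ N₂) : x ≠ y := by
  rintro rfl
  rcases h with h | h
  · exact hd.notMem_of_mem_left h.1 h.2
  · exact hd.notMem_of_mem_left h.2 h.1

theorem Opposite.adj {x y : W} (h : Opposite N₁ N₂ x y) (hN : N₁ ∪ N₂ = G.neighborSet v) :
    G.Adj v x ∧ G.Adj v y := by
  have key : ∀ u, u ∈ N₁ ∨ u ∈ N₂ → G.Adj v u := fun u hu => by
    rw [← SimpleGraph.mem_neighborSet, ← hN]; exact hu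
  rcases h with h | h
  · exact ⟨key _ (Or.inl h.1), key _ (Or.inr h.2)⟩
  · exact ⟨key _ (Or.inr h.1), key _ (Or.inl h.2)⟩

/-- It suffices to change a bijective row at `v` in one place, to a color of the other side. -/
theorem HasSplitColoring.of_row (hN : N₁ ∪ N₂ = G.neighborSet v) (hd : Disjoint N₁ N₂) {w z : W}
    {f : W → W → C} (hf : IsPole G {v} {s(w, z)} f) {h : W → C} (hh : IsRow G v h) {x y : W}
    (hxy : Opposite N₁ N₂ x y) (hx : f x v = h y) (ho : ∀ u, G.Adj v u → u ≠ x → f u v = h u) :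
    HasSplitColoring C G v N₁ N₂ w z := by
  obtain ⟨hvx, hvy⟩ := hxy.adj hN
  have hne := hxy.ne hd
  have hyx : ∀ u, G.Adj v u → f u v = f x v → u = x ∨ u = y := by
    intro u hu h1
    by_cases hux : u = x
    · exact Or.inl hux
    · rw [ho u hu hux, hx] at h1
      exact Or.inr (hh.eq_of_eq hu hvy h1)
  have key : ∀ u u', G.Adj v u → G.Adj v u' → ¬ Opposite N₁ N₂ u u' → f u v = f u' v → u = u' := by
    intro u u' hu hu' hopp heq
    by_cases hux : u = x
    · subst hux
      rcases hyx u' hu' heq.symm with h1 | rfl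
      · exact h1.symm
      · exact absurd hxy hopp
    · by_cases hux' : u' = x
      · subst hux'
        rcases hyx u hu heq with h1 | rfl
        · exact h1
        · exact absurd hxy.symm hopp
      · rw [ho u hu hux, ho u' hu' hux'] at heq
        exact hh.eq_of_eq hu hu' heq
  have hadj : ∀ u, u ∈ N₁ ∨ u ∈ N₂ → G.Adj v u := fun u hu => by
    rw [← SimpleGraph.mem_neighborSet, ← hN]; exact hu
  -- The color `h x` has disappeared at `v` and is free for the new edge; `h y` occurs twice, at `x`
  -- and `y`, but on different sides.
  refine ⟨f, h x, hf, ?_, ?_, ?_⟩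
  · intro u hu u' hu' heq
    refine key u u' (hadj u (Or.inl hu)) (hadj u' (Or.inl hu')) ?_ heq
    rintro (h1 | h1)
    · exact hd.notMem_of_mem_left hu' h1.2
    · exact hd.notMem_of_mem_left hu h1.1
  · intro u hu u' hu' heq
    refine key u u' (hadj u (Or.inr hu)) (hadj u' (Or.inr hu')) ?_ heq
    rintro (h1 | h1)
    · exact hd.notMem_of_mem_left h1.1 hu
    · exact hd.notMem_of_mem_left h1.2 hu'
  · intro u hu heq
    by_cases hux : u = x
    · subst hux
      rw [hx] at heq
      exact hne (hh.eq_of_eq hvy hvx heq).symm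
    · rw [ho u hu hux] at heq
      exact hux (hh.eq_of_eq hu hvx heq)

open Classical in
/-- If the edge `wz` is not repairable and the colors of `wz` and `vy` belong to different sides
of `v`, then `wz` can be given the color of `vy` while the colors at `v` are kept. -/
theorem exists_switch [Finite W] (hN : N₁ ∪ N₂ = G.neighborSet v) (hd : Disjoint N₁ N₂)
    {w z : W} (hwz : G.Adj w z) (hwv : w ≠ v) (hzv : z ≠ v)
    (hbad : ¬ HasSplitColoring C G v N₁ N₂ w z) {f : W → W → C} (hf : IsPole G ∅ ∅ f) {x y : W}
    (hxy : Opposite N₁ N₂ x y) (hx : f v x = f w z) :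
    ∃ f' : W → W → C, IsPole G ∅ ∅ f' ∧ (∀ u, G.Adj v u → f' v u = f v u) ∧ f' w z = f v y ∧
      ∀ a b, f' a b = f a b ∨ f' a b = Equiv.swap (f w z) (f v y) (f a b) := by
  obtain ⟨hvx, hvy⟩ := hxy.adj hN
  have hrow := hf.1 v (by simp)
  have hsym : ∀ a b, G.Adj a b → f a b = f b a := fun a b hab =>
    hf.2 a b hab (by simp) (by simp) (by simp)
  have hcb : f w z ≠ f v y := fun h => hxy.ne hd (hrow.eq_of_eq hvx hvy (hx.trans h))
  have hpole : IsPole G {v} {s(w, z)} f := hf.mono (by simp) (by simp)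
  have hterm : ∀ u, G.Adj v u → IsTerminal G {v} {s(w, z)} (u, v) := fun u hu =>
    ⟨hu.symm, by simpa using hu.ne', by simp⟩
  have hwzt : IsTerminal G {v} {s(w, z)} (w, z) := ⟨hwz, by simpa using hwv, by simp⟩
  -- The chain in the colors of `wz` and `vy` starts at the half of `wz` at `w`. If it ended at `v`,
  -- it would end at `x` or at `y` and exchange these two colors in one place, which repairs `wz`.
  -- So it ends at the other half of `wz`, and the recolored halves can be glued.
  obtain ⟨⟨a, b⟩, hl', hne, hcol, f', hf', hff', h1, h2, h3⟩ :=
    hpole.exists_pair_swap (e := Equiv.swap (f w z) (f v y)) (fun c => Equiv.swap_apply_self _ _ c)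
      hwzt (by simpa using hcb.symm)
  simp only [Equiv.swap_apply_left] at hcol h1 h2 hff'
  obtain ⟨hab, hav, hb⟩ := hl'
  rcases hb with hb | hb
  · exfalso
    obtain rfl : b = v := hb
    have hba := hab.symm
    dsimp only at hcol h2 hab hba
    rw [hsym a b hab] at hcol h2
    rcases hcol with h | h
    · obtain rfl := hrow.eq_of_eq hba hvx (h.trans hx.symm)
      refine hbad (.of_row hN hd hf' hrow hxy (by rw [h2, h, Equiv.swap_apply_left]) ?_)
      intro u hu hua
      rw [h3 (u, b) (hterm u hu) (by simp [hzv.symm]) (by simpa using hua), hsym u b hu.symm]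
    · obtain rfl := hrow.eq_of_eq hba hvy h
      refine hbad (.of_row hN hd hf' hrow hxy.symm (by rw [h2, Equiv.swap_apply_right, hx]) ?_)
      intro u hu hua
      rw [h3 (u, b) (hterm u hu) (by simp [hzv.symm]) (by simpa using hua), hsym u b hu.symm]
  · have hzw : (a, b) = (z, w) := by
      have : s(a, b) = s(w, z) := hb
      rcases Sym2.eq_iff.1 this with h | h
      · exact absurd (Prod.ext h.1 h.2) hne
      · exact Prod.ext h.1 h.2
    obtain ⟨rfl, rfl⟩ := Prod.ext_iff.1 hzw
    dsimp only at *
    rw [← hsym b a hwz, Equiv.swap_apply_left] at h2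
    have hres := IsPole.restore (R := ∅) (x := v) (by simpa using hf') hrow (fun u hu _ _ => by
      rw [h3 (u, v) (hterm u hu) (by simp [hzv.symm]) (by simp [hwv.symm]), hsym u v hu.symm])
    refine ⟨_, hres.glue ?_, ?_, ?_, ?_⟩
    · intro p q hpq
      rcases Sym2.eq_iff.1 hpq with h | h <;> simp [h.1, h.2, hwv, hzv, h1, h2]
    · intro u hu; simp
    · simp [hwv, h1]
    · intro p q
      by_cases hp : p = v
      · subst hp; simp
      · simpa [hp] using hff' p q

theorem side_of_color (hN : N₁ ∪ N₂ = G.neighborSet v) {f : W → W → C} (hf : IsPole G ∅ ∅ f) (c : C) :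
    (∃ y ∈ N₁, f v y = c) ∨ ∃ y ∈ N₂, f v y = c := by
  obtain ⟨y, ⟨hy, hc⟩, -⟩ := hf.1 v (by simp) c
  have : y ∈ N₁ ∪ N₂ := by rw [hN]; exact hy
  exact this.imp (fun h => ⟨y, h, hc⟩) (fun h => ⟨y, h, hc⟩)

/-- Edges incident with a neighbor of `v` are repairable, one side. -/
theorem hasSplitColoring_of_mem_left [Finite W] (hN : N₁ ∪ N₂ = G.neighborSet v) (hd : Disjoint N₁ N₂)
    (hN₂ : N₂.Nonempty) {f : W → W → C} (hf : IsPole G ∅ ∅ f)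
    {x w : W} (hx : x ∈ N₁) (hxw : G.Adj x w) (hwv : w ≠ v) :
    HasSplitColoring C G v N₁ N₂ x w := by
  classical
  have hvx : G.Adj v x := by
    rw [← SimpleGraph.mem_neighborSet, ← hN]; exact Or.inl hx
  have key : ∀ f : W → W → C, IsPole G ∅ ∅ f → (∃ y ∈ N₂, f v y = f x w) →
      HasSplitColoring C G v N₁ N₂ x w := by
    rintro f hf ⟨y, hy, hyc⟩
    have hsym : ∀ a b, G.Adj a b → f a b = f b a := fun a b hab =>
      hf.2 a b hab (by simp) (by simp) (by simp)
    have hpole : IsPole G {v} {s(x, w)} f := hf.mono (by simp) (by simp)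
    -- Since `xw` is missing, its color can be used at `x` for the edge `xv`.
    have hex := hpole.exchange (u := x) (y₁ := v) (y₂ := w)
      ⟨hvx.symm, by simpa using hvx.ne', by simp⟩ ⟨hxw, by simpa using hvx.ne', by simp⟩
    refine .of_row hN hd hex (hf.1 v (by simp)) (Or.inl ⟨hx, hy⟩) (by simp [hyc]) ?_
    intro u hu hux
    simp [hux, hsym u v hu.symm]
  rcases side_of_color hN hf (f x w) with ⟨y, hy, hyc⟩ | h
  · obtain ⟨y', hy'⟩ := hN₂
    by_contra hbad
    obtain ⟨f', hf', h1, h2, -⟩ := exists_switch hN hd hxw hvx.ne' hwv hbad hf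
      (Or.inl ⟨hy, hy'⟩) hyc
    have hvy' : G.Adj v y' := by
      rw [← SimpleGraph.mem_neighborSet, ← hN]; exact Or.inr hy'
    exact hbad (key f' hf' ⟨y', hy', by rw [h1 y' hvy', h2]⟩)
  · exact key f hf h

/-- If `wz` is not repairable, an edge from `w` to a vertex of `N₁` can be given a color
that appears at `v` on the side `N₂`. -/
theorem exists_color_mem_right [Finite W] (hN : N₁ ∪ N₂ = G.neighborSet v) (hd : Disjoint N₁ N₂)
    (hN₂ : N₂.Nonempty) {w z x : W} (hwz : G.Adj w z) (hwv : w ≠ v)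
    (hzv : z ≠ v) (hbad : ¬ HasSplitColoring C G v N₁ N₂ w z) {f : W → W → C}
    (hf : IsPole G ∅ ∅ f) (hwx : G.Adj w x) (hxz : x ≠ z) :
    ∃ f' : W → W → C, IsPole G ∅ ∅ f' ∧ ∃ y ∈ N₂, f' v y = f' w x := by
  classical
  have hadj₁ : ∀ u ∈ N₁, G.Adj v u := fun u hu => by
    rw [← SimpleGraph.mem_neighborSet, ← hN]; exact Or.inl hu
  have hadj₂ : ∀ u ∈ N₂, G.Adj v u := fun u hu => by
    rw [← SimpleGraph.mem_neighborSet, ← hN]; exact Or.inr hu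
  -- When `wz` takes over the color of `wx`, the edge `wx` is forced to take the former color of
  -- `wz`, which lies on the side `N₂`.
  have key : ∀ f : W → W → C, IsPole G ∅ ∅ f → (∃ y ∈ N₁, f v y = f w x) →
      (∃ y ∈ N₂, f v y = f w z) →
      ∃ f' : W → W → C, IsPole G ∅ ∅ f' ∧ ∃ y ∈ N₂, f' v y = f' w x := by
    rintro f hf ⟨y, hy, hyc⟩ ⟨y', hy', hyc'⟩
    obtain ⟨f', hf', h1, h2, h3⟩ := exists_switch hN hd hwz hwv hzv hbad hf
      (Or.inr ⟨hy', hy⟩) hyc'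
    refine ⟨f', hf', y', hy', ?_⟩
    rw [h1 y' (hadj₂ y' hy'), hyc']
    have h4 : f' w x ≠ f v y := fun h =>
      hxz ((hf'.1 w (by simp)).eq_of_eq hwx hwz (h.trans h2.symm))
    rcases h3 w x with h | h
    · exact absurd (h.trans hyc.symm) h4
    · rw [h, ← hyc, Equiv.swap_apply_right]
  rcases side_of_color hN hf (f w x) with hp | hp
  · rcases side_of_color hN hf (f w z) with ⟨y, hy, hyc⟩ | hc
    · obtain ⟨y', hy'⟩ := hN₂
      obtain ⟨f', hf', h1, h2, h3⟩ := exists_switch hN hd hwz hwv hzv hbad hf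
        (Or.inl ⟨hy, hy'⟩) hyc
      refine key f' hf' ?_ ⟨y', hy', by rw [h1 y' (hadj₂ y' hy'), h2]⟩
      obtain ⟨u, hu, huc⟩ := hp
      refine ⟨u, hu, ?_⟩
      rw [h1 u (hadj₁ u hu), huc]
      rcases h3 w x with h | h
      · exact h.symm
      · rw [h, Equiv.swap_apply_of_ne_of_ne]
        · exact fun h' => hxz ((hf.1 w (by simp)).eq_of_eq hwx hwz h')
        · intro h'
          have := (hf.1 v (by simp)).eq_of_eq (hadj₁ u hu) (hadj₂ y' hy') (huc.trans h')
          subst this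
          exact hd.notMem_of_mem_left hu hy'
    · exact key f hf hp hc
  · exact ⟨f, hf, hp⟩

/-- Edges at distance one from a vertex of `N₁` are repairable if `N₂` has two elements. -/
theorem hasSplitColoring_of_nontrivial [Finite W] (hN : N₁ ∪ N₂ = G.neighborSet v) (hd : Disjoint N₁ N₂)
    (hN₂ : N₂.Nontrivial) {w z x : W} (hwz : G.Adj w z)
    (hwv : w ≠ v) (hzv : z ≠ v) {f : W → W → C} (hf : IsPole G ∅ ∅ f) (hx : x ∈ N₁)
    (hwx : G.Adj w x) (hxz : x ≠ z) : HasSplitColoring C G v N₁ N₂ w z := by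
  classical
  by_contra hbad
  have hvx : G.Adj v x := by
    rw [← SimpleGraph.mem_neighborSet, ← hN]; exact Or.inl hx
  have hadj₂ : ∀ u ∈ N₂, G.Adj v u := fun u hu => by
    rw [← SimpleGraph.mem_neighborSet, ← hN]; exact Or.inr hu
  obtain ⟨f, hf, hp, hc⟩ : ∃ f : W → W → C, IsPole G ∅ ∅ f ∧ (∃ y ∈ N₂, f v y = f w x) ∧
      ∃ y ∈ N₂, f v y = f w z := by
    obtain ⟨f, hf, y, hy, hyc⟩ :=
      exists_color_mem_right hN hd hN₂.nonempty hwz hwv hzv hbad hf hwx hxz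
    rcases side_of_color hN hf (f w z) with ⟨t, ht, htc⟩ | hc
    -- A second element of `N₂` lets `wz` move to an `N₂` color other than that of `wx`, so `wx`
    -- keeps its color.
    · obtain ⟨y', hy', hne⟩ := hN₂.exists_ne y
      obtain ⟨f', hf', h1, h2, h3⟩ := exists_switch hN hd hwz hwv hzv hbad hf
        (Or.inl ⟨ht, hy'⟩) htc
      refine ⟨f', hf', ⟨y, hy, ?_⟩, ⟨y', hy', by rw [h1 y' (hadj₂ y' hy'), h2]⟩⟩
      rw [h1 y (hadj₂ y hy), hyc]
      rcases h3 w x with h | h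
      · exact h.symm
      · rw [h, Equiv.swap_apply_of_ne_of_ne]
        · exact fun h' => hxz ((hf.1 w (by simp)).eq_of_eq hwx hwz h')
        · intro h'
          exact hne ((hf.1 v (by simp)).eq_of_eq (hadj₂ y' hy') (hadj₂ y hy)
            (h'.symm.trans hyc.symm))
    · exact ⟨f, hf, ⟨y, hy, hyc⟩, hc⟩
  obtain ⟨y₁, hy₁, hp⟩ := hp
  obtain ⟨y₂, hy₂, hc⟩ := hc
  have hsym : ∀ a b, G.Adj a b → f a b = f b a := fun a b hab =>
    hf.2 a b hab (by simp) (by simp) (by simp)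
  have hrow := hf.1 v (by simp)
  have hrowx := hf.1 x (by simp)
  have hxy₁ : x ≠ y₁ := fun h => hd.notMem_of_mem_left hx (h ▸ hy₁)
  have hxy₂ : x ≠ y₂ := fun h => hd.notMem_of_mem_left hx (h ▸ hy₂)
  have hac : f x v ≠ f w z := fun h =>
    hxy₂ (hrow.eq_of_eq hvx (hadj₂ y₂ hy₂) (by rw [hc, ← h, hsym x v hvx.symm]))
  have hy₁₂ : y₁ ≠ y₂ := by
    rintro rfl
    exact hxz ((hf.1 w (by simp)).eq_of_eq hwx hwz (hp.symm.trans hc))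
  -- With `x` deleted too, the chain in the colors of `wz` and `xv` from the half at `w` can end at
  -- `x`, at `v`, or at the other half of `wz`.
  have hpole : IsPole G {x, v} {s(w, z)} f := hf.mono (by simp) (by simp)
  have hwzt : IsTerminal G {x, v} {s(w, z)} (w, z) := ⟨hwz, by simp [hwx.ne, hwv], by simp⟩
  have htv : ∀ u, G.Adj v u → u ≠ x → IsTerminal G {x, v} {s(w, z)} (u, v) := fun u hu hux =>
    ⟨hu.symm, by simp [hu.ne', hux], by simp⟩
  have htx : ∀ u, G.Adj x u → u ≠ v → IsTerminal G {x, v} {s(w, z)} (u, x) := fun u hu huv =>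
    ⟨hu.symm, by simp [hu.ne', huv], by simp⟩
  obtain ⟨⟨a, b⟩, hl', hne, hcol, f', hf', hff', h1, h2, h3⟩ :=
    hpole.exists_pair_swap (e := Equiv.swap (f w z) (f x v)) (fun c => Equiv.swap_apply_self _ _ c)
      hwzt (by simpa using hac)
  simp only [Equiv.swap_apply_left] at hcol h1 h2 hff' h3 hne
  obtain ⟨hab, hav, hb⟩ := hl'
  simp only [Set.mem_insert_iff, Set.mem_singleton_iff, not_or] at hav hab hb
  -- The chain has given the half of `wz` at `w` the color of `xv`. Exchanging it with the half of
  -- `wx` at `w` gives `wx` the old color of `xv`, so `xv` may take the old color of `wx`, which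
  -- belongs to `y₁` on the other side.
  have finish : ∀ {h : W → C}, IsRow G v h → h y₁ = f w x →
      (∀ u, G.Adj v u → u ≠ x → f' u v = h u) →
      (∀ u, G.Adj x u → u ≠ v → f' u x = f u x) → False := by
    intro h hh hhy hfv hfx
    have hex := hf'.exchange (u := w) (y₁ := z) (y₂ := x) hwzt
      (htx w hwx.symm hwv)
    have hres := IsPole.restore (R := {v}) (x := x) hex
      (hrowx.comp_swap hvx.symm hwx.symm) (fun u hu huv _ => by
        have huv : u ≠ v := huv
        by_cases huw : u = w
        · subst huw; simp [h1]
        · simp only [huw, if_false]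
          rw [Equiv.swap_apply_of_ne_of_ne huv huw, hfx u hu huv, hsym x u hu])
    refine hbad (.of_row hN hd hres hh (Or.inl ⟨hx, hy₁⟩) ?_ ?_)
    · simp [hhy, hsym x w hwx.symm]
    · intro u hu hux
      by_cases huw : u = w
      · subst huw
        have : v ≠ x := hvx.ne
        simp only [hux, if_false, if_true]
        rw [Equiv.swap_apply_of_ne_of_ne hzv.symm this, hfv u hu hux]
      · simp [hux, huw, hfv u hu hux]
  rcases hb with (rfl | rfl) | hb
  · -- the chain ends at `x`
    have hca : f a b = f w z := by
      rcases hcol with h | h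
      · exact h
      · exact absurd (hrowx.eq_of_eq hab.symm hvx.symm ((hsym b a hab.symm).trans h)) hav.2
    rw [hca, Equiv.swap_apply_left] at h2
    -- The edge from `x` to the end of the chain now has the old color of `xv`; in return `xv` takes
    -- the color of `wz`, which belongs to `y₂`.
    have hres := IsPole.restore (R := {v}) (x := b) hf'
      (hrowx.comp_swap hvx.symm hab.symm) (fun u hu huv _ => by
        have huv : u ≠ v := huv
        by_cases hua : u = a
        · subst hua; simp [h2]
        · rw [Equiv.swap_apply_of_ne_of_ne huv hua,
            h3 (u, b) (htx u hu huv) (by simp [hxz]) (by simp [hua]), hsym b u hu])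
    refine hbad (.of_row hN hd hres hrow (Or.inl ⟨hx, hy₂⟩) ?_ ?_)
    · simp [hc, hsym b a hab.symm, hca]
    · intro u hu hux
      simp only [hux, if_false]
      rw [h3 (u, v) (htv u hu hux) (by simp [hzv.symm]) (by simp [hvx.ne]), hsym u v hu.symm]
  · -- the chain ends at `v`
    have hay : a = y₂ := by
      rcases hcol with h | h
      · exact hrow.eq_of_eq hab.symm (hadj₂ y₂ hy₂) ((hsym b a hab.symm).trans (h.trans hc.symm))
      · exact absurd (hrow.eq_of_eq hab.symm hvx
          ((hsym b a hab.symm).trans (h.trans (hsym x b hvx.symm)))) hav.1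
    subst hay
    have hca : f a b = f w z := by rw [hsym a b hab, hc]
    rw [hca, Equiv.swap_apply_left] at h2
    -- The chain gave `y₂v` the color of `vx`, so the reference row at `v` has these two colors
    -- exchanged.
    refine finish (hrow.comp_swap hvx hab.symm) ?_ ?_ ?_
    · rw [Equiv.swap_apply_of_ne_of_ne hxy₁.symm hy₁₂, hp]
    · intro u hu hux
      by_cases hua : u = a
      · subst hua; simp [h2, hsym x b hvx.symm]
      · rw [Equiv.swap_apply_of_ne_of_ne hux hua,
          h3 (u, b) (htv u hu hux) (by simp [hzv.symm]) (by simp [hua]), hsym u b hu.symm]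
    · intro u hu huv
      rw [h3 (u, x) (htx u hu huv) (by simp [hxz]) (by simp [hvx.ne'])]
  · have hzw : (a, b) = (z, w) := by
      rcases Sym2.eq_iff.1 hb with h | h
      · exact absurd (Prod.ext h.1 h.2) hne
      · exact Prod.ext h.1 h.2
    obtain ⟨rfl, rfl⟩ := Prod.ext_iff.1 hzw
    refine finish hrow hp ?_ ?_
    · intro u hu hux
      rw [h3 (u, v) (htv u hu hux) (by simp [hzv.symm]) (by simp [hwv.symm]), hsym u v hu.symm]
    · intro u hu huv
      rw [h3 (u, x) (htx u hu huv) (by simp [hxz]) (by simp [hwx.ne'])]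

end Splitting

/-! ### Finite analysis of the boundary colors under Kempe changes -/

section Boundary

variable {ι C : Type*} [DecidableEq ι]

/-- Apply `e` to the entries of `μ` indexed by `S`. -/
def recolor (μ : ι → C) (e : C → C) (S : Finset ι) : ι → C :=
  fun k => if k ∈ S then e (μ k) else μ k

/-- A set of boundary colorings closed under Kempe changes. -/
def KempeClosed (B : Set (ι → C)) : Prop :=
  ∀ μ ∈ B, ∀ e : C → C, Involutive e → ∃ π : ι → ι,
    (∀ k, e (μ k) ≠ μ k → π k ≠ k ∧ π (π k) = k ∧ (μ (π k) = μ k ∨ μ (π k) = e (μ k))) ∧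
    ∀ S : Finset ι, (∀ k ∈ S, π k ∈ S) → recolor μ e S ∈ B

theorem pairing_four {ι : Type*} {π : ι → ι} {a b c d : ι} (hb : b ≠ c ∧ b ≠ d ∧ c ≠ d)
    (h : ∀ k, k = a ∨ k = b ∨ k = c ∨ k = d →
      (π k = a ∨ π k = b ∨ π k = c ∨ π k = d) ∧ π k ≠ k ∧ π (π k) = k) :
    (π c = d ∧ π d = c) ∨ (π b = d ∧ π d = b) ∨ (π b = c ∧ π c = b) := by
  have ha := h a (by simp)
  have hb₀ := h b (by simp)
  have hc := h c (by simp)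
  have hd := h d (by simp)
  grind

/-- Four moved terminals form two pairs. Only the pair avoiding `a` is recolored: recoloring the
other one instead differs by applying `e` everywhere. -/
theorem KempeClosed.four {B : Set (ι → C)} (hB : KempeClosed B) {μ : ι → C} (hμ : μ ∈ B)
    {e : C → C} (he : Involutive e) (a b c d : ι)
    (hb : b ≠ c ∧ b ≠ d ∧ c ≠ d)
    (hcls : ∀ k, e (μ k) ≠ μ k ↔ k = a ∨ k = b ∨ k = c ∨ k = d) :
    recolor μ e {c, d} ∈ B ∨ recolor μ e {b, d} ∈ B ∨ recolor μ e {b, c} ∈ B := by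
  obtain ⟨π, hπ, hS⟩ := hB μ hμ e he
  have key : ∀ {k k'}, π k = k' ∧ π k' = k → recolor μ e {k, k'} ∈ B := fun {k k'} h =>
    hS _ (by intro l hl; simp only [Finset.mem_insert, Finset.mem_singleton] at hl ⊢; grind)
  refine (pairing_four (π := π) (a := a) hb fun k hk => ?_).imp key (Or.imp key key)
  obtain ⟨h1, h2, h3⟩ := hπ k ((hcls k).2 hk)
  refine ⟨(hcls _).1 ?_, h1, h2⟩
  have := (hcls k).2 hk
  rcases h3 with h | h <;> rw [h]
  · exact this
  · rw [he]; exact this.symm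

/-- A single involution acting on two classes of four terminals keeps one pairing for both, so `P`,
`Q` and their union can all be recolored from the same coloring. -/
theorem KempeClosed.eight {B : Set (ι → C)} (hB : KempeClosed B) {μ : ι → C} (hμ : μ ∈ B)
    {e : C → C} (he : Involutive e) (a b c d a' b' c' d' : ι)
    (hb : b ≠ c ∧ b ≠ d ∧ c ≠ d) (hb' : b' ≠ c' ∧ b' ≠ d' ∧ c' ≠ d')
    (hne : ∀ k, e (μ k) ≠ μ k)
    (hcls : ∀ k k', μ k' = μ k ∨ μ k' = e (μ k) → k = a ∨ k = b ∨ k = c ∨ k = d →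
      k' = a ∨ k' = b ∨ k' = c ∨ k' = d)
    (hcls' : ∀ k k', μ k' = μ k ∨ μ k' = e (μ k) → k = a' ∨ k = b' ∨ k = c' ∨ k = d' →
      k' = a' ∨ k' = b' ∨ k' = c' ∨ k' = d') :
    ∃ P Q : Finset ι, (P = {c, d} ∨ P = {b, d} ∨ P = {b, c}) ∧
      (Q = {c', d'} ∨ Q = {b', d'} ∨ Q = {b', c'}) ∧
      recolor μ e P ∈ B ∧ recolor μ e Q ∈ B ∧ recolor μ e (P ∪ Q) ∈ B := by
  obtain ⟨π, hπ, hS⟩ := hB μ hμ e he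
  have key : ∀ {k k' : ι}, π k = k' ∧ π k' = k → ∀ l ∈ ({k, k'} : Finset ι),
      π l ∈ ({k, k'} : Finset ι) := fun {k k'} h => by
    intro l hl; simp only [Finset.mem_insert, Finset.mem_singleton] at hl ⊢; grind
  have hP : ∃ P : Finset ι, (P = {c, d} ∨ P = {b, d} ∨ P = {b, c}) ∧ ∀ l ∈ P, π l ∈ P := by
    rcases pairing_four (π := π) (a := a) hb fun k hk =>
      ⟨hcls k _ (hπ k (hne k)).2.2 hk, (hπ k (hne k)).1, (hπ k (hne k)).2.1⟩ with h | h | h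
    exacts [⟨_, by simp, key h⟩, ⟨_, by simp, key h⟩, ⟨_, by simp, key h⟩]
  have hQ : ∃ P : Finset ι, (P = {c', d'} ∨ P = {b', d'} ∨ P = {b', c'}) ∧
      ∀ l ∈ P, π l ∈ P := by
    rcases pairing_four (π := π) (a := a') hb' fun k hk =>
      ⟨hcls' k _ (hπ k (hne k)).2.2 hk, (hπ k (hne k)).1, (hπ k (hne k)).2.1⟩ with h | h | h
    exacts [⟨_, by simp, key h⟩, ⟨_, by simp, key h⟩, ⟨_, by simp, key h⟩]
  obtain ⟨P, hP, hPc⟩ := hP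
  obtain ⟨Q, hQ, hQc⟩ := hQ
  refine ⟨P, Q, hP, hQ, hS _ hPc, hS _ hQc, hS _ fun l hl => ?_⟩
  rw [Finset.mem_union] at hl ⊢
  exact hl.imp (hPc l) (hQc l)

/-- The boundary coloring extends over the deleted vertex, and the first two entries differ. -/
abbrev IsGoodBoundary (μ : Fin 8 → Fin 4) : Prop :=
  μ 0 ≠ μ 1 ∧ μ 4 ≠ μ 5 ∧ μ 4 ≠ μ 6 ∧ μ 4 ≠ μ 7 ∧ μ 5 ≠ μ 6 ∧ μ 5 ≠ μ 7 ∧ μ 6 ≠ μ 7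

/-- The terminals are, in this order, the halves of `sv`, `vs`, `wz`, `zw` and the edges from
`v`, `w`, `z` and a fourth vertex to the deleted vertex. -/
theorem exists_isGoodBoundary {B : Set (Fin 8 → Fin 4)} (hB : KempeClosed B)
    (hv : ∀ μ ∈ B, μ ∘ Equiv.swap 1 4 ∈ B) (hw : ∀ μ ∈ B, μ ∘ Equiv.swap 2 5 ∈ B)
    (hz : ∀ μ ∈ B, μ ∘ Equiv.swap 3 6 ∈ B) (hne : ∀ μ ∈ B, μ 1 ≠ μ 4)
    (hT : ![0, 0, 3, 3, 1, 2, 0, 3] ∈ B) : ∃ μ ∈ B, IsGoodBoundary μ := by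
  -- With `x` the deleted vertex, colors 0, 1, 2, 3 are those of `vs`, `vx`, `wx`, `wz`; initially
  -- `zx` also has color 0 and the fourth edge at `x` color 3. Exchanging 0 with 2 and 1 with 3
  -- splits the terminals into the classes 0, 1, 5, 6 and 2, 3, 4, 7.
  obtain ⟨P, Q, hP, hQ, hBP, hBQ, hBPQ⟩ := hB.eight hT (e := ![2, 3, 0, 1]) (by unfold Involutive; decide)
    0 1 5 6 2 3 4 7 (by decide) (by decide) (by decide) (by decide) (by decide)
  rcases hP with rfl | rfl | rfl
  · rcases hQ with rfl | rfl | rfl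
    · exact ⟨_, hz _ (hv _ hBQ), by decide⟩
    · exact ⟨_, hw _ (hv _ hBPQ), by decide⟩
    · exact ⟨_, hz _ (hv _ hBQ), by decide⟩
  · rcases hB.four hBP (e := Equiv.swap 0 3) (by unfold Involutive; decide) 0 2 3 7
        (by decide) (by decide) with h | h | h
    · exact ⟨_, hw _ h, by decide⟩
    · exact ⟨_, hz _ h, by decide⟩
    · exact ⟨_, hw _ h, by decide⟩
  · rcases hQ with rfl | rfl | rfl
    · exact ⟨_, hz _ (hv _ hBQ), by decide⟩
    · rcases hB.four hBPQ (e := Equiv.swap 1 2) (by unfold Involutive; decide) 1 4 3 7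
        (by decide) (by decide) with h | h | h
      · exact ⟨_, hw _ h, by decide⟩
      -- This pairing would produce a repeated color at `v`, so it cannot occur.
      · exact absurd (by decide) (hne _ h)
      · exact absurd (by decide) (hne _ h)
    · rcases hB.four hBPQ (e := Equiv.swap 2 3) (by unfold Involutive; decide) 1 4 2 7
        (by decide) (by decide) with h | h | h
      · exact ⟨_, hz _ h, by decide⟩
      · exact absurd (by decide) (hne _ h)
      · exact absurd (by decide) (hne _ h)

end Boundary

/-! ### Boundary colorings realized by a pole -/

section Realization

variable {W C : Type*} {G : SimpleGraph W} {R : Set W} {K : Set (Sym2 W)}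

/-- The boundary colorings `μ` of the terminals `t` that come from colorings of the pole which
agree with `f₀` on all other terminals. -/
def realized {ι κ : Type*} (G : SimpleGraph W) (R : Set W) (K : Set (Sym2 W)) (f₀ : W → W → C)
    (t : ι → W × W) (col : κ → C) : Set (ι → κ) :=
  {μ | ∃ f : W → W → C, IsPole G R K f ∧ (∀ k, f (t k).1 (t k).2 = col (μ k)) ∧
    ∀ l, IsTerminal G R K l → l ∉ Set.range t → f l.1 l.2 = f₀ l.1 l.2}

variable {ι κ : Type*} [DecidableEq ι] {f₀ : W → W → C} {t : ι → W × W} {col : κ → C}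

/-- A Kempe change among the colors in `col` pairs terminals with such colors only, and by `hout`
these are all among the `t k`. -/
theorem kempeClosed_realized [Finite W] (ht : Injective t) (hcol : Injective col)
    (htT : ∀ k, IsTerminal G R K (t k))
    (hout : ∀ l, IsTerminal G R K l → l ∉ Set.range t → f₀ l.1 l.2 ∉ Set.range col) :
    KempeClosed (realized G R K f₀ t col) := by
  classical
  rintro μ ⟨f, hf, hft, hf₀⟩ e he
  -- `e` transported along `col`, and the identity on all other colors.
  let E : C → C := fun c => if h : ∃ j, col j = c then col (e h.choose) else c
  have hE : ∀ j, E (col j) = col (e j) := fun j => by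
    have h : ∃ j', col j' = col j := ⟨j, rfl⟩
    simp only [E, dif_pos h]
    rw [hcol h.choose_spec]
  have hE' : ∀ c, c ∉ Set.range col → E c = c := fun c hc => dif_neg hc
  have hEinv : Involutive E := by
    intro c
    by_cases hc : c ∈ Set.range col
    · obtain ⟨j, rfl⟩ := hc
      rw [hE, hE, he]
    · rw [hE' c hc, hE' c hc]
  obtain ⟨π, hπ, hS⟩ := hf.exists_kempe_pairing hEinv
  have hact : ∀ k, e (μ k) ≠ μ k → E (f (t k).1 (t k).2) ≠ f (t k).1 (t k).2 := fun k hk => by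
    rw [hft, hE]; exact fun h => hk (hcol h)
  have hrange : ∀ k, e (μ k) ≠ μ k → π (t k) ∈ Set.range t := by
    intro k hk
    obtain ⟨h1, -, -, h4⟩ := hπ _ (htT k) (hact k hk)
    by_contra hn
    apply hout _ h1 hn
    rw [← hf₀ _ h1 hn]
    rw [hft, hE] at h4
    rcases h4 with h | h <;> rw [h] <;> exact ⟨_, rfl⟩
  choose p hp using hrange
  have hp' : ∀ k (hk : e (μ k) ≠ μ k), p k hk ≠ k ∧
      (μ (p k hk) = μ k ∨ μ (p k hk) = e (μ k)) := by
    intro k hk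
    obtain ⟨-, h2, h3, h4⟩ := hπ _ (htT k) (hact k hk)
    rw [← hp k hk] at h2 h4
    rw [hft, hft, hE] at h4
    exact ⟨fun h => h2 (congrArg t h), h4.imp (fun h => hcol h) (fun h => hcol h)⟩
  have hpact : ∀ k (hk : e (μ k) ≠ μ k), e (μ (p k hk)) ≠ μ (p k hk) := by
    intro k hk
    rcases (hp' k hk).2 with h | h <;> rw [h]
    · exact hk
    · rw [he]; exact hk.symm
  refine ⟨fun k => if hk : e (μ k) ≠ μ k then p k hk else k, fun k hk => ?_, fun S hSc => ?_⟩
  · simp only [dif_pos hk, dif_pos (hpact k hk)]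
    refine ⟨(hp' k hk).1, ?_, (hp' k hk).2⟩
    apply ht
    rw [hp, hp]
    exact (hπ _ (htT k) (hact k hk)).2.2.1
  · obtain ⟨f', hf', -, h2⟩ := hS (t '' {k | k ∈ S ∧ e (μ k) ≠ μ k}) (by
      rintro _ ⟨k, ⟨hkS, hk⟩, rfl⟩
      refine ⟨p k hk, ⟨?_, hpact k hk⟩, hp k hk⟩
      simpa [hk] using hSc k hkS)
    refine ⟨f', hf', fun k => ?_, fun l hl hlt => ?_⟩
    · by_cases hkS : k ∈ S
      · by_cases hk : e (μ k) ≠ μ k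
        · rw [(h2 _ (htT k)).1 ⟨k, ⟨hkS, hk⟩, rfl⟩, hft, hE]
          simp [recolor, hkS]
        · rw [(h2 _ (htT k)).2 ?_, hft]
          · simp [recolor, hkS, not_not.1 hk]
          · rintro ⟨k', ⟨-, h⟩, hkk⟩
            exact hk (ht hkk ▸ h)
      · rw [(h2 _ (htT k)).2 ?_, hft]
        · simp [recolor, hkS]
        · rintro ⟨k', ⟨h, -⟩, hkk⟩
          exact hkS (ht hkk ▸ h)
    · rw [(h2 l hl).2 ?_, hf₀ l hl hlt]
      rintro ⟨k, -, rfl⟩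
      exact hlt ⟨k, rfl⟩

theorem realized_comp_swap (ht : Injective t) (htT : ∀ k, IsTerminal G R K (t k)) {j k : ι}
    (hjk : (t j).1 = (t k).1) {μ : ι → κ} (hμ : μ ∈ realized G R K f₀ t col) :
    μ ∘ Equiv.swap j k ∈ realized G R K f₀ t col := by
  classical
  obtain ⟨f, hf, hft, hf₀⟩ := hμ
  have hj : IsTerminal G R K ((t j).1, (t j).2) := htT j
  have hk : IsTerminal G R K ((t j).1, (t k).2) := by rw [hjk]; exact htT k
  refine ⟨_, hf.exchange hj hk, fun l => ?_, fun l hl hlt => ?_⟩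
  · by_cases hl : (t l).1 = (t j).1
    · rw [if_pos hl]
      by_cases hlj : l = j
      · subst hlj; simp [hjk, hft]
      · by_cases hlk : l = k
        · subst hlk; simp [hft]
        · have h1 : (t l).2 ≠ (t j).2 := fun h => hlj (ht (Prod.ext hl h))
          have h2 : (t l).2 ≠ (t k).2 := fun h => hlk (ht (Prod.ext (hl.trans hjk) h))
          rw [Equiv.swap_apply_of_ne_of_ne h1 h2, comp_apply,
            Equiv.swap_apply_of_ne_of_ne hlj hlk, ← hft, hl]
    · rw [if_neg hl, hft, comp_apply, Equiv.swap_apply_of_ne_of_ne]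
      · rintro rfl; exact hl rfl
      · rintro rfl; exact hl hjk.symm
  · by_cases h : l.1 = (t j).1
    · have h1 : l.2 ≠ (t j).2 := fun h' => hlt ⟨j, (Prod.ext h h').symm⟩
      have h2 : l.2 ≠ (t k).2 := fun h' => hlt ⟨k, (Prod.ext (h.trans hjk) h').symm⟩
      rw [if_pos h, Equiv.swap_apply_of_ne_of_ne h1 h2, ← h, hf₀ l hl hlt]
    · rw [if_neg h, hf₀ l hl hlt]

end Realization

/-! ### One side of the partition is a single vertex -/

section Subdivision

variable {W C : Type*} {G : SimpleGraph W} {v : W}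

theorem IsRow.of_injOn [Finite C] {u : W} {h₀ h : W → C} (h₀r : IsRow G u h₀)
    (hinj : ∀ y y', G.Adj u y → G.Adj u y' → h y = h y' → y = y') : IsRow G u h := by
  choose r hr using fun c => (h₀r c).exists
  have hr_inj : Injective fun c => h (r c) := by
    intro c c' hc
    rw [← (hr c).2, ← (hr c').2, hinj _ _ (hr c).1 (hr c').1 hc]
  intro c
  obtain ⟨c', hc'⟩ := (Finite.injective_iff_surjective.1 hr_inj) c
  exact ⟨r c', ⟨(hr c').1, hc'⟩, fun y hy => hinj _ _ hy.1 (hr c').1 (hy.2.trans hc'.symm)⟩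

/-- When the edge `vs` is subdivided it suffices to color the graph with `x` deleted and the
edges `vs`, `wz` cut such that the two halves of `vs` get different colors. -/
theorem HasSplitColoring.of_cut {N₁ : Set W} {s w z x : W}
    (hN : N₁ ∪ {s} = G.neighborSet v) (hd : Disjoint N₁ {s}) (hwv : w ≠ v) (hzv : z ≠ v)
    (hx : x ∈ N₁) {f : W → W → C} (hf : IsPole G {x} {s(v, s), s(w, z)} f)
    (hrow : IsRow G x fun u => f u x) (hne : f s v ≠ f v s) :
    HasSplitColoring C G v N₁ {s} w z := by
  classical
  have hadj : ∀ u ∈ N₁, G.Adj v u := fun u hu => by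
    rw [← SimpleGraph.mem_neighborSet, ← hN]; exact Or.inl hu
  have hvs : G.Adj v s := by rw [← SimpleGraph.mem_neighborSet, ← hN]; exact Or.inr rfl
  have hs : ∀ u ∈ N₁, u ≠ s := fun u hu h => hd.notMem_of_mem_left hu h
  have hvx := hadj x hx
  have hres := IsPole.restore (R := ∅) (x := x) (by simpa using hf) hrow (fun u _ _ _ => rfl)
  have hpole := hres.mono (R' := {v}) (K' := {s(w, z)}) (by simp) (by
    rintro a b (h | h)
    · rcases Sym2.eq_iff.1 h with h | h <;> simp [h.1, h.2]
    · exact Or.inl h)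
  have hval : ∀ u ∈ N₁, (if u = x then f v x else f u v) = f v u := by
    intro u hu
    by_cases hux : u = x
    · simp [hux]
    · rw [if_neg hux]
      refine hf.2 u v (hadj u hu).symm hux hvx.ne ?_
      rintro (h | h)
      · rcases Sym2.eq_iff.1 h with h | h
        · exact (hadj u hu).ne h.1.symm
        · exact hs u hu h.1
      · rcases Sym2.eq_iff.1 h with h | h
        · exact hzv h.2.symm
        · exact hwv h.2.symm
  have hv := hf.1 v hvx.ne
  -- The half of `vs` at `v` becomes the new edge and the half at `s` the edge from `s` to the
  -- subdividing vertex.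
  refine ⟨_, f v s, hpole, ?_, ?_, ?_⟩
  · intro u hu u' hu' h
    simp only [hval u hu, hval u' hu'] at h
    exact hv.eq_of_eq (hadj u hu) (hadj u' hu') h
  · exact Set.injOn_singleton _ _
  · intro u hu
    have hmem : u ∈ N₁ ∪ {s} := by rw [hN]; exact hu
    rcases hmem with hmem | rfl
    · simp only [hval u hmem]
      exact fun h => hs u hmem (hv.eq_of_eq hu hvs h)
    · have : u ≠ x := (hs x hx).symm
      simpa [this] using hne

/-- When an edge `vs` is subdivided, the edges that form a triangle with a neighbor of `v` are
repairable. -/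
theorem hasSplitColoring_of_triangle [Finite W] [Finite C] {N₁ : Set W} {s w z x : W}
    (hN : N₁ ∪ {s} = G.neighborSet v) (hd : Disjoint N₁ {s}) (hwz : G.Adj w z) (hwv : w ≠ v)
    (hzv : z ≠ v) {f : W → W → C} (hf : IsPole G ∅ ∅ f) (hx : x ∈ N₁) (hwx : G.Adj w x)
    (hzx : G.Adj z x) : HasSplitColoring C G v N₁ {s} w z := by
  classical
  by_contra hbad
  -- Used with `w` and `z` interchanged: as `s` is the whole second side, `zx` gets precisely the
  -- color of `vs`.
  obtain ⟨f, hf, y', hy', hZ⟩ := exists_color_mem_right hN hd (Set.singleton_nonempty s)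
    hwz.symm hzv hwv (fun h => hbad h.swap_ends) hf hzx hwx.ne'
  obtain rfl : y' = s := hy'
  have hsym : ∀ a b, G.Adj a b → f a b = f b a := fun a b hab =>
    hf.2 a b hab (by simp) (by simp) (by simp)
  have hr : ∀ u, IsRow G u (f u) := fun u => hf.1 u (by simp)
  have hvx : G.Adj v x := by rw [← SimpleGraph.mem_neighborSet, ← hN]; exact Or.inl hx
  have hvs : G.Adj v y' := by rw [← SimpleGraph.mem_neighborSet, ← hN]; exact Or.inr rfl
  have hxs : x ≠ y' := fun h => hd.notMem_of_mem_left hx h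
  have hxz := hzx.ne'
  have hxw := hwx.ne'
  have hpole : IsPole G {x} {s(v, y'), s(w, z)} f := hf.mono (by simp) (by simp)
  have hia : f v y' ≠ f v x := fun h => hxs ((hr v).eq_of_eq hvs hvx h).symm
  have hvst : IsTerminal G {x} {s(v, y'), s(w, z)} (v, y') := ⟨hvs, hvx.ne, by simp⟩
  have hsvt : IsTerminal G {x} {s(v, y'), s(w, z)} (y', v) :=
    ⟨hvs.symm, hxs.symm, by simp [Sym2.eq_swap]⟩
  have hwzt : IsTerminal G {x} {s(v, y'), s(w, z)} (w, z) := ⟨hwz, hwx.ne, by simp⟩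
  have hzwt : IsTerminal G {x} {s(v, y'), s(w, z)} (z, w) :=
    ⟨hwz.symm, hzx.ne, by simp [Sym2.eq_swap]⟩
  have hxt : ∀ u, G.Adj u x → IsTerminal G {x} {s(v, y'), s(w, z)} (u, x) := fun u hu =>
    ⟨hu, hu.ne, by simp⟩
  -- If `wz` and `vx` share a color, exchanging `vs` with `vx` at `v` and `zw` with `zx` at `z`
  -- merely swaps the colors of `vx` and `zx` at `x`, while the halves of `vs` now differ.
  by_cases hqa : f w z = f v x
  · have h1 := hpole.exchange hvst (hxt v hvx)
    have h2 := h1.exchange hzwt (hxt z hzx)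
    refine hbad (.of_cut hN hd hwv hzv hx h2
      (((hr x).comp_swap hvx.symm hzx.symm).congr fun u hu => ?_) ?_)
    · by_cases huz : u = z
      · subst huz
        simp [hzv, hqa, hsym x v hvx.symm, ← hsym w u hwz]
      · by_cases huv : u = v
        · subst huv
          simp [huz, hZ, hsym x z hzx.symm]
        · simp [huz, huv, Equiv.swap_apply_of_ne_of_ne huv huz, hsym x u hu]
    · have hsv : y' ≠ v := hvs.ne'
      simp only [hsv, hzv.symm, if_false, if_true, Equiv.swap_apply_left]
      by_cases hyz : y' = z
      · subst hyz
        rw [if_pos rfl, if_neg hsv, Equiv.swap_apply_of_ne_of_ne hwv.symm hvx.ne, hsym y' v hvs.symm]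
        exact hia
      · simp [hyz, hsym y' v hvs.symm, hia]
  -- The fourth vertex is the neighbor of `x` reached by the color of `wz`. Together `z`, `v`, `w`,
  -- `y` account for all four colors in the row of `x`, so every other terminal avoids them.
  · obtain ⟨y, ⟨hxy, hyc⟩, -⟩ := hr x (f w z)
    have hpq : f w x ≠ f w z := fun h => hxz ((hr w).eq_of_eq hwx hwz h)
    have hip : f v y' ≠ f w x := fun h => hwz.ne ((hr x).eq_of_eq hwx.symm hzx.symm (by
      rw [hsym x w hwx.symm, ← h, hZ, hsym z x hzx]))
    have hiq : f v y' ≠ f w z := fun h => hxw ((hr z).eq_of_eq hzx hwz.symm (by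
      rw [← hZ, h, hsym w z hwz]))
    have hap : f v x ≠ f w x := fun h => hwv ((hr x).eq_of_eq hwx.symm hvx.symm (by
      rw [hsym x w hwx.symm, ← h, hsym v x hvx]))
    have hyv : y ≠ v := by
      rintro rfl; exact hqa (by rw [← hyc, hsym x y hxy])
    have hyw : y ≠ w := by
      rintro rfl; exact hpq (by rw [← hyc, hsym x y hxy])
    have hyz : y ≠ z := by
      rintro rfl; exact hiq (by rw [← hyc, hZ, hsym x y hxy])
    let t : Fin 8 → W × W :=
      ![(y', v), (v, y'), (w, z), (z, w), (v, x), (w, x), (z, x), (y, x)]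
    let col : Fin 4 → C := ![f v y', f v x, f w x, f w z]
    have hcol : Injective col := by
      intro i j hij
      fin_cases i <;> fin_cases j <;> simp_all [col, eq_comm]
    have ht : Injective t := by
      intro i j hij
      have hsv := hvs.ne
      have hvx' := hvx.ne
      have hwz' := hwz.ne
      fin_cases i <;> fin_cases j <;> first | rfl | (exfalso; simp [t] at hij; grind)
    have htT : ∀ k, IsTerminal G {x} {s(v, y'), s(w, z)} (t k) := by
      intro k
      fin_cases k
      exacts [hsvt, hvst, hwzt, hzwt, hxt v hvx, hxt w hwx, hxt z hzx, hxt y hxy.symm]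
    have hcase : ∀ l, IsTerminal G {x} {s(v, y'), s(w, z)} l → l ∉ Set.range t →
        l.2 = x ∧ l.1 ≠ v ∧ l.1 ≠ w ∧ l.1 ≠ z ∧ l.1 ≠ y := by
      rintro ⟨a, b⟩ ⟨-, -, hl⟩ hnt
      have hnt' : ∀ k, t k ≠ (a, b) := fun k h => hnt ⟨k, h⟩
      have h0 := hnt' 0
      have h1 := hnt' 1
      have h2 := hnt' 2
      have h3 := hnt' 3
      have h4 := hnt' 4
      have h5 := hnt' 5
      have h6 := hnt' 6
      have h7 := hnt' 7
      simp only [t] at h0 h1 h2 h3 h4 h5 h6 h7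
      simp at h0 h1 h2 h3 h4 h5 h6 h7
      rcases hl with hl | hl | hl
      · obtain rfl : b = x := hl
        grind
      · rcases Sym2.eq_iff.1 hl with h | h <;> grind
      · rcases Sym2.eq_iff.1 hl with h | h <;> grind
    have hout : ∀ l, IsTerminal G {x} {s(v, y'), s(w, z)} l → l ∉ Set.range t →
        f l.1 l.2 ∉ Set.range col := by
      intro l hl hnt
      obtain ⟨hlx, hlv, hlw, hlz, hly⟩ := hcase l hl hnt
      have hadj : G.Adj x l.1 := by have := hl.1; rw [hlx] at this; exact this.symm
      rw [hlx, hsym l.1 x hadj.symm]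
      rintro ⟨k, hk⟩
      fin_cases k <;> simp [col] at hk
      · exact hlz ((hr x).eq_of_eq hadj hzx.symm (by rw [← hk, hZ, hsym z x hzx]))
      · exact hlv ((hr x).eq_of_eq hadj hvx.symm (by rw [← hk, hsym v x hvx]))
      · exact hlw ((hr x).eq_of_eq hadj hwx.symm (by rw [← hk, hsym w x hwx]))
      · exact hly ((hr x).eq_of_eq hadj hxy (by rw [← hk, hyc]))
    obtain ⟨μ, ⟨g, hg, hgt, hg₀⟩, hgood⟩ := exists_isGoodBoundary
      (kempeClosed_realized ht hcol htT hout)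
      (fun μ hμ => realized_comp_swap (j := 1) (k := 4) ht htT rfl hμ)
      (fun μ hμ => realized_comp_swap (j := 2) (k := 5) ht htT rfl hμ)
      (fun μ hμ => realized_comp_swap (j := 3) (k := 6) ht htT rfl hμ)
      (by
        rintro μ ⟨g, hg, hgt, -⟩ h
        have h1 : g v y' = g v x := by
          have h1 := hgt 1
          have h4 := hgt 4
          rw [h, ← h4] at h1
          exact h1
        exact hxs ((hg.1 v hvx.ne).eq_of_eq hvs hvx h1).symm)
      ⟨f, hpole, by
        intro k
        fin_cases k
        · exact hsym _ _ hvs.symm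
        · rfl
        · rfl
        · exact hsym _ _ hwz.symm
        · rfl
        · rfl
        · exact hZ.symm
        · exact (hsym _ _ hxy.symm).trans hyc, fun _ _ _ => rfl⟩
    obtain ⟨g01, g45, g46, g47, g56, g57, g67⟩ := hgood
    have hgv : g v x = col (μ 4) := hgt 4
    have hgw : g w x = col (μ 5) := hgt 5
    have hgz : g z x = col (μ 6) := hgt 6
    have hgy : g y x = col (μ 7) := hgt 7
    have hgo : ∀ u, G.Adj x u → u ≠ v → u ≠ w → u ≠ z → u ≠ y →
        g u x = f u x ∧ f u x ∉ Set.range col := by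
      intro u hu huv huw huz huy
      have hnt : (u, x) ∉ Set.range t := by
        rintro ⟨k, hk⟩
        have hvx' := hvx.ne
        fin_cases k <;> simp [t] at hk <;> grind
      exact ⟨hg₀ (u, x) (hxt u hu.symm) hnt, hout (u, x) (hxt u hu.symm) hnt⟩
    refine hbad (.of_cut hN hd hwv hzv hx hg ((hr x).of_injOn ?_) ?_)
    · have hin : ∀ u, G.Adj x u → (∃ k, g u x = col (μ k) ∧ (k = 4 ∧ u = v ∨ k = 5 ∧ u = w ∨
          k = 6 ∧ u = z ∨ k = 7 ∧ u = y)) ∨ (g u x = f u x ∧ f u x ∉ Set.range col) := by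
        intro u hu
        by_cases huv : u = v
        · subst huv; exact Or.inl ⟨4, hgv, by simp⟩
        by_cases huw : u = w
        · subst huw; exact Or.inl ⟨5, hgw, by simp⟩
        by_cases huz : u = z
        · subst huz; exact Or.inl ⟨6, hgz, by simp⟩
        by_cases huy : u = y
        · subst huy; exact Or.inl ⟨7, hgy, by simp⟩
        exact Or.inr (hgo u hu huv huw huz huy)
      intro u u' hu hu' h
      rcases hin u hu with ⟨k, hk, hku⟩ | ⟨h1, h2⟩ <;>
        rcases hin u' hu' with ⟨k', hk', hku'⟩ | ⟨h1', h2'⟩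
      · rw [hk, hk'] at h
        have hμ := hcol h
        rcases hku with ⟨rfl, rfl⟩ | ⟨rfl, rfl⟩ | ⟨rfl, rfl⟩ | ⟨rfl, rfl⟩ <;>
          rcases hku' with ⟨rfl, rfl⟩ | ⟨rfl, rfl⟩ | ⟨rfl, rfl⟩ | ⟨rfl, rfl⟩ <;>
          first | rfl | exact absurd hμ (by assumption) | exact absurd hμ.symm (by assumption)
      · exact absurd ⟨μ k, by rw [← hk, h, h1']⟩ h2'
      · exact absurd ⟨μ k', by rw [← hk', ← h, h1]⟩ h2
      · rw [h1, h1', ← hsym x u hu, ← hsym x u' hu'] at h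
        exact (hr x).eq_of_eq hu hu' h
    · have h0 : g y' v = col (μ 0) := hgt 0
      have h1 : g v y' = col (μ 1) := hgt 1
      rw [h0, h1]
      exact fun h => g01 (hcol h)

end Subdivision

/-! ### Common neighbors from the degree bound -/

section Counting

variable {W : Type*}

theorem exists_mem_inter_of_card_lt [DecidableEq W] {U A B D : Finset W} (hA : A ⊆ U) (hB : B ⊆ U)
    (hD : D ⊆ U) (h : 2 * U.card < A.card + B.card + D.card) : ∃ x, x ∈ A ∧ x ∈ B ∧ x ∈ D := by
  by_contra hne
  have h1 := Finset.card_union_add_card_inter A B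
  have h2 := Finset.card_union_add_card_inter (A ∩ B) D
  have h3 : (A ∩ B) ∩ D = ∅ := by
    ext x
    simp only [Finset.mem_inter, Finset.notMem_empty, iff_false]
    exact fun h => hne ⟨x, h.1.1, h.1.2, h.2⟩
  rw [h3, Finset.card_empty] at h2
  have h4 := Finset.card_le_card (Finset.union_subset hA hB)
  have h5 := Finset.card_le_card
    (Finset.union_subset (Finset.inter_subset_left.trans hA : A ∩ B ⊆ U) hD)
  omega

/-- If `G` is regular of large degree, every edge that avoids `v` is repairable. -/
theorem hasSplitColoring_of_regular [Fintype W] {G : SimpleGraph W} [DecidableRel G.Adj] {Δ : ℕ}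
    (hreg : G.IsRegularOfDegree Δ) (hΔ : 2 * Fintype.card W ≤ 3 * Δ + 2) {C : Type*} [Finite C]
    {v : W} {N₁ N₂ : Set W} (hN : N₁ ∪ N₂ = G.neighborSet v) (hd : Disjoint N₁ N₂)
    (hN₁ : N₁.Nonempty) (hN₂ : N₂.Nonempty) {f : W → W → C} (hf : IsPole G ∅ ∅ f) {w z : W}
    (hwz : G.Adj w z) (hwv : w ≠ v) (hzv : z ≠ v) : HasSplitColoring C G v N₁ N₂ w z := by
  classical
  have hN' : N₂ ∪ N₁ = G.neighborSet v := by rw [Set.union_comm, hN]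
  have hcard : ∀ u, (G.neighborFinset u).card = Δ := fun u => hreg u
  have hmem : ∀ u, G.Adj v u → u ∈ N₁ ∨ u ∈ N₂ := fun u hu => by
    have : u ∈ N₁ ∪ N₂ := by rw [hN]; exact hu
    exact this
  have hnear : ∀ a b, G.Adj a b → b ≠ v → G.Adj v a → HasSplitColoring C G v N₁ N₂ a b := by
    intro a b hab hb ha
    rcases hmem a ha with h | h
    · exact hasSplitColoring_of_mem_left hN hd hN₂ hf h hab hb
    · exact (hasSplitColoring_of_mem_left hN' hd.symm hN₁ hf h hab hb).swap_sides
  by_cases hvw : G.Adj v w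
  · exact hnear w z hwz hzv hvw
  by_cases hvz : G.Adj v z
  · exact (hnear z w hwz.symm hwv hvz).swap_ends
  have hsub : ∀ {M₁ : Set W} {s : W}, M₁ ∪ {s} = G.neighborSet v → Disjoint M₁ {s} →
      HasSplitColoring C G v M₁ {s} w z := by
    intro M₁ s hM hMd
    have hvs : G.Adj v s := by rw [← SimpleGraph.mem_neighborSet, ← hM]; exact Or.inr rfl
    have hsw : s ≠ w := by rintro rfl; exact hvw hvs
    have hsz : s ≠ z := by rintro rfl; exact hvz hvs
    -- As `v` is adjacent to neither `w` nor `z`, the neighborhoods leave at least Δ - 1, Δ - 2 and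
    -- Δ - 2 elements in `U`. A common one exists if 2(m - 4) < 3Δ - 5, which is exactly `hΔ`.
    let U : Finset W := Finset.univ \ {v, w, z, s}
    have hU : U.card + 4 = Fintype.card W := by
      rw [← Finset.card_univ, ← Finset.card_sdiff_add_card_eq_card
        (Finset.subset_univ ({v, w, z, s} : Finset W))]
      congr 1
      rw [Finset.card_insert_of_notMem, Finset.card_insert_of_notMem,
        Finset.card_insert_of_notMem, Finset.card_singleton]
      · simpa using hsz.symm
      · simp [hwz.ne, hsw.symm]
      · simp [hwv.symm, hzv.symm, hvs.ne]
    have hA : ((G.neighborFinset v).erase s).card + 1 = Δ := by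
      rw [Finset.card_erase_add_one (by simpa using hvs), hcard]
    have hBD : ∀ u u', Δ ≤ (((G.neighborFinset u).erase u').erase s).card + 2 := by
      intro u u'
      have h1 := Finset.pred_card_le_card_erase (s := G.neighborFinset u) (a := u')
      have h2 := Finset.pred_card_le_card_erase (s := (G.neighborFinset u).erase u') (a := s)
      rw [hcard] at h1
      omega
    have hB := hBD w z
    have hD := hBD z w
    have hpos : 1 ≤ Δ := by
      rw [← hcard v]
      exact Finset.card_pos.2 ⟨s, by simpa using hvs⟩
    obtain ⟨x, hxA, hxB, hxD⟩ := exists_mem_inter_of_card_lt (U := U)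
      (A := (G.neighborFinset v).erase s) (B := ((G.neighborFinset w).erase z).erase s)
      (D := ((G.neighborFinset z).erase w).erase s) (by
        intro x
        simp only [Finset.mem_erase, SimpleGraph.mem_neighborFinset, U, Finset.mem_sdiff,
          Finset.mem_univ, true_and, Finset.mem_insert, Finset.mem_singleton, not_or]
        rintro ⟨hxs, hx⟩
        exact ⟨hx.ne', fun h => hvw (h ▸ hx), fun h => hvz (h ▸ hx), hxs⟩) (by
        intro x
        simp only [Finset.mem_erase, SimpleGraph.mem_neighborFinset, U, Finset.mem_sdiff,
          Finset.mem_univ, true_and, Finset.mem_insert, Finset.mem_singleton, not_or]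
        rintro ⟨hxs, hxz, hx⟩
        exact ⟨fun h => hvw (h ▸ hx.symm), hx.ne', hxz, hxs⟩) (by
        intro x
        simp only [Finset.mem_erase, SimpleGraph.mem_neighborFinset, U, Finset.mem_sdiff,
          Finset.mem_univ, true_and, Finset.mem_insert, Finset.mem_singleton, not_or]
        rintro ⟨hxs, hxw, hx⟩
        exact ⟨fun h => hvz (h ▸ hx.symm), hxw, hx.ne', hxs⟩) (by omega)
    simp only [Finset.mem_erase, SimpleGraph.mem_neighborFinset] at hxA hxB hxD
    have hx : x ∈ M₁ := by
      have : x ∈ M₁ ∪ {s} := by rw [hM]; exact hxA.2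
      exact this.resolve_right hxA.1
    exact hasSplitColoring_of_triangle hM hMd hwz hwv hzv hf hx hxB.2.2 hxD.2.2
  rcases hN₂.exists_eq_singleton_or_nontrivial with ⟨s, rfl⟩ | hN₂t
  · exact hsub hN hd
  rcases hN₁.exists_eq_singleton_or_nontrivial with ⟨s, rfl⟩ | hN₁t
  · exact (hsub hN' hd.symm).swap_sides
  -- Two neighborhoods of size Δ among m - 2 vertices must meet; the triple count is reused with `U`
  -- itself as third set.
  obtain ⟨x, hxv, hxw⟩ : ∃ x, G.Adj v x ∧ G.Adj w x := by
    let U : Finset W := Finset.univ \ {v, w}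
    have hU : U.card + 2 = Fintype.card W := by
      rw [← Finset.card_univ, ← Finset.card_sdiff_add_card_eq_card
        (Finset.subset_univ ({v, w} : Finset W)), Finset.card_pair hwv.symm]
    obtain ⟨x, h1, h2, -⟩ := exists_mem_inter_of_card_lt (U := U)
      (A := G.neighborFinset v) (B := G.neighborFinset w) (D := U) (by
        intro x
        simp only [SimpleGraph.mem_neighborFinset, U, Finset.mem_sdiff,
          Finset.mem_univ, true_and, Finset.mem_insert, Finset.mem_singleton, not_or]
        exact fun hx => ⟨hx.ne', fun h => hvw (h ▸ hx)⟩) (by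
        intro x
        simp only [SimpleGraph.mem_neighborFinset, U, Finset.mem_sdiff,
          Finset.mem_univ, true_and, Finset.mem_insert, Finset.mem_singleton, not_or]
        exact fun hx => ⟨fun h => hvw (h ▸ hx.symm), hx.ne'⟩) subset_rfl (by
        rw [hcard, hcard]; omega)
    simp only [SimpleGraph.mem_neighborFinset] at h1 h2
    exact ⟨x, h1, h2⟩
  have hxz : x ≠ z := by rintro rfl; exact hvz hxv
  rcases hmem x hxv with h | h
  · exact hasSplitColoring_of_nontrivial hN hd hN₂t hwz hwv hzv hf h hxw hxz
  · exact (hasSplitColoring_of_nontrivial hN' hd.symm hN₁t hwz hwv hzv hf h hxw hxz).swap_sides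

end Counting

/-! ### Edge colorings as colorings of the line graph -/

section LineGraph

variable {V V' C : Type*}

theorem chromaticIndex_le_iff {G : SimpleGraph V} {k : ℕ} :
    chromaticIndex G ≤ k ↔ G.lineGraph.Colorable k :=
  SimpleGraph.chromaticNumber_le_iff_colorable

theorem colorable_lineGraph_of_copy {G : SimpleGraph V} {G' : SimpleGraph V'} {k : ℕ}
    (φ : SimpleGraph.Copy G G') (h : G'.lineGraph.Colorable k) : G.lineGraph.Colorable k :=
  h.of_hom φ.toLineGraphEmbedding

/-- An edge coloring given as a symmetric function of the endpoints. -/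
theorem nonempty_lineGraph_coloring {G : SimpleGraph V} (g : V → V → C)
    (hsym : ∀ u y, G.Adj u y → g u y = g y u)
    (hinj : ∀ u y y', G.Adj u y → G.Adj u y' → g u y = g u y' → y = y') :
    Nonempty (G.lineGraph.Coloring C) := by
  have hval : ∀ e : G.edgeSet, ∃ c, ∀ u y, s(u, y) = e.1 → g u y = c := by
    rintro ⟨e, he⟩
    induction e with
    | _ a b =>
      refine ⟨g a b, fun u y h => ?_⟩
      rcases Sym2.eq_iff.1 h with ⟨rfl, rfl⟩ | ⟨rfl, rfl⟩
      · rfl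
      · exact (hsym _ _ he).symm
  choose c hc using hval
  refine ⟨SimpleGraph.Coloring.mk c ?_⟩
  rintro e e' ⟨hne, u, hu, hu'⟩ heq
  obtain ⟨y, hy⟩ := Sym2.mem_iff_exists.1 (show u ∈ e.1 from hu)
  obtain ⟨y', hy'⟩ := Sym2.mem_iff_exists.1 (show u ∈ e'.1 from hu')
  have h1 : G.Adj u y := by rw [← SimpleGraph.mem_edgeSet, ← hy]; exact e.2
  have h2 : G.Adj u y' := by rw [← SimpleGraph.mem_edgeSet, ← hy']; exact e'.2
  rw [← hc e u y hy.symm, ← hc e' u y' hy'.symm] at heq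
  have := hinj u y y' h1 h2 heq
  subst this
  exact hne (Subtype.ext (hy.trans hy'.symm))

theorem exists_symm_coloring {G : SimpleGraph V} [Nonempty C] (c : G.lineGraph.Coloring C) :
    ∃ g : V → V → C, (∀ u y, G.Adj u y → g u y = g y u) ∧
      ∀ u y y', G.Adj u y → G.Adj u y' → g u y = g u y' → y = y' := by
  classical
  refine ⟨fun u y => if h : G.Adj u y then c ⟨s(u, y), h⟩ else Classical.arbitrary C, ?_, ?_⟩
  · intro u y h
    simp only [dif_pos h, dif_pos h.symm]
    congr 2
    exact Sym2.eq_swap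
  · intro u y y' h h' heq
    simp only [dif_pos h, dif_pos h'] at heq
    by_contra hne
    refine c.valid (v := ⟨s(u, y), h⟩) (w := ⟨s(u, y'), h'⟩) ⟨?_, u, ?_, ?_⟩ heq
    · intro h1
      rcases Sym2.eq_iff.1 (congrArg Subtype.val h1) with h2 | h2
      · exact hne h2.2
      · exact h.ne h2.2.symm
    · exact Sym2.mem_mk_left u y
    · exact Sym2.mem_mk_left _ _

/-- A color class of an edge coloring has at most `⌊|V| / 2⌋` edges. -/
theorem card_edgeFinset_le [Fintype V] {G : SimpleGraph V} [DecidableRel G.Adj] {k : ℕ}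
    (h : G.lineGraph.Colorable k) : G.edgeFinset.card ≤ k * (Fintype.card V / 2) := by
  classical
  obtain ⟨c⟩ := h
  have hfib : ∀ i, ((Finset.univ : Finset G.edgeSet).filter (fun e => c e = i)).card ≤
      Fintype.card V / 2 := by
    intro i
    rw [Nat.le_div_iff_mul_le two_pos]
    rw [← Finset.sum_const_nat (m := 2) (f := fun e : G.edgeSet => e.1.toFinset.card)
      fun e _ => Sym2.card_toFinset_of_not_isDiag _ (G.not_isDiag_of_mem_edgeSet e.2),
      ← Finset.card_biUnion]
    · exact Finset.card_le_univ _
    · intro e he e' he' hne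
      rw [onFun, Finset.disjoint_left]
      intro u hu hu'
      rw [Sym2.mem_toFinset] at hu hu'
      simp only [Finset.coe_filter, Finset.mem_univ, true_and, Set.mem_ofPred_eq] at he he'
      exact c.valid (v := e) (w := e') ⟨hne, u, hu, hu'⟩ (he.trans he'.symm)
  have h1 := Finset.card_eq_sum_card_fiberwise (s := (Finset.univ : Finset G.edgeSet))
    (t := Finset.univ) (f := c) (by simp)
  rw [SimpleGraph.edgeFinset_card, ← Finset.card_univ, h1]
  calc _ ≤ ∑ _i : Fin k, Fintype.card V / 2 := Finset.sum_le_sum fun i _ => hfib i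
    _ = _ := by simp

/-- An edge coloring of a regular graph with as many colors as the degree uses every color at
every vertex. -/
theorem exists_isPole_of_regular [Fintype V] {G : SimpleGraph V} [DecidableRel G.Adj] {Δ : ℕ}
    (hreg : G.IsRegularOfDegree Δ) (hΔ : 0 < Δ) (h : G.lineGraph.Colorable Δ) :
    ∃ f : V → V → Fin Δ, IsPole G ∅ ∅ f := by
  classical
  obtain ⟨c⟩ := h
  have : Nonempty (Fin Δ) := ⟨⟨0, hΔ⟩⟩
  obtain ⟨g, hsym, hinj⟩ := exists_symm_coloring c
  refine ⟨g, fun u _ i => ?_, fun u y huy _ _ _ => hsym u y huy⟩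
  have himg : (G.neighborFinset u).image (g u) = Finset.univ := by
    apply Finset.eq_univ_of_card
    rw [Finset.card_image_of_injOn, Fintype.card_fin]
    · exact hreg u
    · intro y hy y' hy' heq
      exact hinj u y y' (by simpa using hy) (by simpa using hy') heq
  have hi : i ∈ (G.neighborFinset u).image (g u) := by rw [himg]; exact Finset.mem_univ i
  obtain ⟨y, hy, hyi⟩ := Finset.mem_image.1 hi
  rw [SimpleGraph.mem_neighborFinset] at hy
  exact ⟨y, ⟨hy, hyi⟩, fun y' hy' => hinj u y' y hy'.1 hy (hy'.2.trans hyi.symm)⟩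

/-- A color class is a perfect matching; exchanging partners is an involution without fixed points.
-/
theorem IsPole.even_card [Fintype V] {G : SimpleGraph V} [Nonempty C] {f : V → V → C}
    (hf : IsPole G ∅ ∅ f) : Even (Fintype.card V) := by
  classical
  obtain ⟨c⟩ := ‹Nonempty C›
  choose m hm hmu using fun u => hf.1 u (by simp) c
  have hmm : ∀ u, m (m u) = u := fun u => (hmu (m u) u ⟨(hm u).1.symm, by
    rw [← hf.2 u (m u) (hm u).1 (by simp) (by simp) (by simp)]; exact (hm u).2⟩).symm
  have h : ∑ u : V, (1 : ZMod 2) = 0 :=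
    Finset.sum_involution (fun u _ => m u) (fun _ _ => by decide) (fun u _ _ => (hm u).1.ne')
      (fun _ _ => Finset.mem_univ _) (fun u _ => hmm u)
  rw [Finset.sum_const, Finset.card_univ, nsmul_eq_mul, mul_one] at h
  exact (ZMod.natCast_eq_zero_iff_even).1 h

end LineGraph

/-! ### Coloring the split graph and its edge-deleted subgraphs -/

section Split

variable {W C : Type*} {G : SimpleGraph W} {v : W} {N₁ N₂ : Set W}

/-- Colors `f` of the edges of `G` and a color `γ` for the new edge give a coloring of a subgraph
of the split graph. -/
theorem nonempty_coloring_of_le_splitGraph (hN : N₁ ∪ N₂ = G.neighborSet v)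
    (hd : Disjoint N₁ N₂) {H : SimpleGraph ({w : W // w ≠ v} ⊕ Bool)}
    (hH : H ≤ splitGraph G v N₁ N₂) (f : W → W → C) (γ : C)
    (hrow : ∀ a ≠ v, ∀ b b', G.Adj a b → G.Adj a b' → f a b = f a b' → b = b')
    (hsym : ∀ a b : {w : W // w ≠ v}, H.Adj (Sum.inl a) (Sum.inl b) → f a b = f b a)
    (hinj : ∀ (i : Bool) (y y' : {w : W // w ≠ v}), H.Adj (Sum.inr i) (Sum.inl y) →
      H.Adj (Sum.inr i) (Sum.inl y') → f y v = f y' v → y = y')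
    (hγ : ∀ (i j : Bool) (y : {w : W // w ≠ v}), H.Adj (Sum.inr i) (Sum.inr j) →
      H.Adj (Sum.inr i) (Sum.inl y) → f y v ≠ γ) :
    Nonempty (H.lineGraph.Coloring C) := by
  have hadj : ∀ u, u ∈ N₁ ∨ u ∈ N₂ → G.Adj u v := fun u hu => by
    rw [G.adj_comm, ← SimpleGraph.mem_neighborSet, ← hN]; exact hu
  have hil : ∀ (a b : {w : W // w ≠ v}), H.Adj (Sum.inl a) (Sum.inl b) → G.Adj a b :=
    fun a b h => hH h
  have hir : ∀ (a : {w : W // w ≠ v}) (i : Bool), H.Adj (Sum.inl a) (Sum.inr i) →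
      ((a : W) ∈ N₁ ∧ i = false) ∨ ((a : W) ∈ N₂ ∧ i = true) := by
    rintro a (_ | _) h
    · exact Or.inl ⟨hH h, rfl⟩
    · exact Or.inr ⟨hH h, rfl⟩
  have hrr : ∀ i j : Bool, H.Adj (Sum.inr i) (Sum.inr j) → i ≠ j := fun i j h => by
    have := h.ne
    simpa using this
  let g : {w : W // w ≠ v} ⊕ Bool → {w : W // w ≠ v} ⊕ Bool → C := fun p q =>
    match p, q with
    | Sum.inl a, Sum.inl b => f a b
    | Sum.inl a, Sum.inr _ => f a v
    | Sum.inr _, Sum.inl b => f b v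
    | Sum.inr _, Sum.inr _ => γ
  refine nonempty_lineGraph_coloring g ?_ ?_
  · rintro (a | i) (b | j) h
    · exact hsym a b h
    · rfl
    · rfl
    · rfl
  · rintro (a | i) (b | j) (b' | j') h h' heq
    · exact congrArg Sum.inl (Subtype.ext (hrow a a.2 b b' (hil a b h) (hil a b' h') heq))
    · exact absurd (hrow a a.2 b v (hil a b h)
        (hadj a ((hir a j' h').imp And.left And.left)) heq) b.2
    · exact absurd (hrow a a.2 v b' (hadj a ((hir a j h).imp And.left And.left))
        (hil a b' h') heq).symm b'.2
    · congr 1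
      rcases hir a j h with ⟨h1, rfl⟩ | ⟨h1, rfl⟩ <;>
        rcases hir a j' h' with ⟨h2, rfl⟩ | ⟨h2, rfl⟩
      · rfl
      · exact absurd h2 (hd.notMem_of_mem_left h1)
      · exact absurd h1 (hd.notMem_of_mem_left h2)
      · rfl
    · exact congrArg Sum.inl (hinj i b b' h h' heq)
    · exact absurd heq (hγ i j' b h' h)
    · exact absurd heq.symm (hγ i j b' h h')
    · congr 1
      have h1 := hrr i j h
      have h2 := hrr i j' h'
      revert h1 h2
      cases i <;> cases j <;> cases j' <;> decide

/-- The old edges keep their colors and the extra color is spent on the new edge. -/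
theorem splitGraph_colorable_succ (hN : N₁ ∪ N₂ = G.neighborSet v) (hd : Disjoint N₁ N₂) {Δ : ℕ}
    {f : W → W → Fin Δ} (hf : IsPole G ∅ ∅ f) :
    (splitGraph G v N₁ N₂).lineGraph.Colorable (Δ + 1) := by
  have hsym : ∀ a b, G.Adj a b → f a b = f b a := fun a b hab =>
    hf.2 a b hab (by simp) (by simp) (by simp)
  have hadj : ∀ i (y : {w : W // w ≠ v}), (splitGraph G v N₁ N₂).Adj (Sum.inr i) (Sum.inl y) →
      G.Adj v y := by
    rintro (_ | _) y h <;> rw [← SimpleGraph.mem_neighborSet, ← hN]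
    · exact Or.inl h
    · exact Or.inr h
  refine nonempty_coloring_of_le_splitGraph hN hd le_rfl (fun a b => (f a b).castSucc)
    (Fin.last Δ) ?_ ?_ ?_ ?_
  · intro a _ b b' h h' heq
    exact (hf.1 a (by simp)).eq_of_eq h h' (Fin.castSucc_injective _ heq)
  · intro a b h
    exact congrArg _ (hsym a b h)
  · intro i y y' h h' heq
    have heq := Fin.castSucc_injective _ heq
    rw [hsym y v (hadj i y h).symm, hsym y' v (hadj i y' h').symm] at heq
    exact Subtype.ext ((hf.1 v (by simp)).eq_of_eq (hadj i y h) (hadj i y' h') heq)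
  · intro i j y _ _
    exact (Fin.castSucc_lt_last _).ne

theorem deleteEdges_colorable_of_hasSplitColoring (hN : N₁ ∪ N₂ = G.neighborSet v)
    (hd : Disjoint N₁ N₂) {Δ : ℕ} {w z : {w : W // w ≠ v}}
    (h : HasSplitColoring (Fin Δ) G v N₁ N₂ w z) :
    ((splitGraph G v N₁ N₂).deleteEdges {s(Sum.inl w, Sum.inl z)}).lineGraph.Colorable Δ := by
  obtain ⟨f, γ, hf, hi₁, hi₂, hγ⟩ := h
  have hside : ∀ i (y : {w : W // w ≠ v}), (splitGraph G v N₁ N₂).Adj (Sum.inr i) (Sum.inl y) →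
      G.Adj v y := by
    rintro (_ | _) y h <;> rw [← SimpleGraph.mem_neighborSet, ← hN]
    · exact Or.inl h
    · exact Or.inr h
  refine nonempty_coloring_of_le_splitGraph hN hd (SimpleGraph.deleteEdges_le _) f γ ?_ ?_ ?_ ?_
  · intro a ha b b' h h' heq
    exact (hf.1 a ha).eq_of_eq h h' heq
  · intro a b h
    rw [SimpleGraph.deleteEdges_adj] at h
    refine hf.2 a b h.1 a.2 b.2 fun h' => h.2 ?_
    rcases Sym2.eq_iff.1 h' with ⟨h1, h2⟩ | ⟨h1, h2⟩
    · rw [Subtype.ext h1, Subtype.ext h2]; rfl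
    · rw [Subtype.ext h1, Subtype.ext h2, Sym2.eq_swap]; rfl
  · rintro (_ | _) y y' h h' heq
    · exact Subtype.ext (hi₁ (SimpleGraph.deleteEdges_le _ h) (SimpleGraph.deleteEdges_le _ h') heq)
    · exact Subtype.ext (hi₂ (SimpleGraph.deleteEdges_le _ h) (SimpleGraph.deleteEdges_le _ h') heq)
  · intro i j y _ h
    exact hγ y (hside i y (SimpleGraph.deleteEdges_le _ h))

/-- Deleting an edge incident with one of the two halves of `v` makes the split graph
`Δ`-edge-colorable: the color of a deleted old edge is used on the new edge. -/
theorem deleteEdges_colorable_of_inr (hN : N₁ ∪ N₂ = G.neighborSet v) (hd : Disjoint N₁ N₂)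
    {Δ : ℕ} {f : W → W → Fin Δ} (hf : IsPole G ∅ ∅ f) (i : Bool) {p : {w : W // w ≠ v} ⊕ Bool}
    (hp : (splitGraph G v N₁ N₂).Adj (Sum.inr i) p) (γ : Fin Δ)
    (hγ : ∀ y : {w : W // w ≠ v}, p = Sum.inl y → f v y = γ) :
    ((splitGraph G v N₁ N₂).deleteEdges {s(Sum.inr i, p)}).lineGraph.Colorable Δ := by
  have hsym : ∀ a b, G.Adj a b → f a b = f b a := fun a b hab =>
    hf.2 a b hab (by simp) (by simp) (by simp)
  have hside : ∀ i (y : {w : W // w ≠ v}), (splitGraph G v N₁ N₂).Adj (Sum.inr i) (Sum.inl y) →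
      G.Adj v y := by
    rintro (_ | _) y h <;> rw [← SimpleGraph.mem_neighborSet, ← hN]
    · exact Or.inl h
    · exact Or.inr h
  have hdis : ∀ i j (y : {w : W // w ≠ v}), (splitGraph G v N₁ N₂).Adj (Sum.inr i) (Sum.inl y) →
      (splitGraph G v N₁ N₂).Adj (Sum.inr j) (Sum.inl y) → i = j := by
    rintro (_ | _) (_ | _) y h h'
    · rfl
    · exact absurd h' (hd.notMem_of_mem_left h)
    · exact absurd h (hd.notMem_of_mem_left h')
    · rfl
  refine nonempty_coloring_of_le_splitGraph hN hd (SimpleGraph.deleteEdges_le _) f γ ?_ ?_ ?_ ?_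
  · intro a ha b b' h h' heq
    exact (hf.1 a (by simp)).eq_of_eq h h' heq
  · intro a b h
    rw [SimpleGraph.deleteEdges_adj] at h
    exact hsym a b h.1
  · intro i y y' h h' heq
    have h := hside i y (SimpleGraph.deleteEdges_le _ h)
    have h' := hside i y' (SimpleGraph.deleteEdges_le _ h')
    rw [hsym y v h.symm, hsym y' v h'.symm] at heq
    exact Subtype.ext ((hf.1 v (by simp)).eq_of_eq h h' heq)
  · intro k j y hkj hky heq
    rw [SimpleGraph.deleteEdges_adj] at hkj hky
    have hy := hside k y hky.1
    rcases p with y' | j'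
    · rw [hsym y v hy.symm, ← hγ y' rfl] at heq
      obtain rfl := Subtype.ext ((hf.1 v (by simp)).eq_of_eq hy (hside i y' hp) heq)
      obtain rfl := hdis _ _ _ hky.1 hp
      exact hky.2 rfl
    · apply hkj.2
      have h1 : i ≠ j' := by simpa using hp.ne
      have h2 : k ≠ j := by simpa using hkj.1.ne
      revert h1 h2
      cases i <;> cases j' <;> cases k <;> cases j <;> simp

end Split

/-! ### Degrees in the split graph -/

section Degree

variable {W : Type*} [Fintype W] {G : SimpleGraph W} {v : W} {N₁ N₂ : Set W}

theorem degree_eq_sum {V : Type*} [Fintype V] (H : SimpleGraph V) [DecidableRel H.Adj] (u : V) :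
    H.degree u = ∑ y, if H.Adj u y then 1 else 0 := by
  rw [← SimpleGraph.card_neighborFinset_eq_degree, ← Finset.card_filter]
  congr 1
  ext y
  simp

open Classical in
theorem degree_splitGraph_inl [DecidableRel G.Adj]
    (hN : N₁ ∪ N₂ = G.neighborSet v) (hd : Disjoint N₁ N₂)
    (x : {w : W // w ≠ v}) : (splitGraph G v N₁ N₂).degree (Sum.inl x) = G.degree x := by
  rw [degree_eq_sum, degree_eq_sum, Fintype.sum_sum_type, Fintype.sum_bool,
    ← Fintype.sum_subtype_add_sum_subtype (fun y => y ≠ v)]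
  have h0 : ∀ y : {w : W // w ≠ v}, (splitGraph G v N₁ N₂).Adj (Sum.inl x) (Sum.inl y) ↔
      G.Adj x y := fun y => Iff.rfl
  have h1 : (splitGraph G v N₁ N₂).Adj (Sum.inl x) (Sum.inr true) ↔ (x : W) ∈ N₂ := Iff.rfl
  have h2 : (splitGraph G v N₁ N₂).Adj (Sum.inl x) (Sum.inr false) ↔ (x : W) ∈ N₁ := Iff.rfl
  have h3 : G.Adj x v ↔ (x : W) ∈ N₁ ∨ (x : W) ∈ N₂ := by
    rw [G.adj_comm, ← SimpleGraph.mem_neighborSet, ← hN]; rfl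
  have h4 : ∑ y : {y : W // ¬ y ≠ v}, (if G.Adj x y then 1 else 0) =
      if G.Adj x v then 1 else 0 := by
    have : Unique {y : W // ¬ y ≠ v} :=
      ⟨⟨⟨v, by simp⟩⟩, fun y => Subtype.ext (not_not.1 y.2)⟩
    rw [Fintype.sum_unique]
    have hv : (default : {y : W // ¬ y ≠ v}).1 = v := not_not.1 (default : {y : W // ¬ y ≠ v}).2
    rw [hv]
  rw [h4]
  simp only [h0, h1, h2, h3]
  congr 1
  by_cases hx₁ : (x : W) ∈ N₁
  · simp [hx₁, hd.notMem_of_mem_left hx₁]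
  · simp [hx₁]

open Classical in
theorem degree_splitGraph_inr_add [DecidableRel G.Adj]
    (hN : N₁ ∪ N₂ = G.neighborSet v) (hd : Disjoint N₁ N₂) :
    (splitGraph G v N₁ N₂).degree (Sum.inr false) + (splitGraph G v N₁ N₂).degree (Sum.inr true) =
      G.degree v + 2 := by
  have hff : ∀ i j : Bool, (splitGraph G v N₁ N₂).Adj (Sum.inr i) (Sum.inr j) ↔ i ≠ j := by
    rintro (_ | _) (_ | _) <;> exact Iff.rfl
  have h1 : ∀ y : {w : W // w ≠ v},
      (splitGraph G v N₁ N₂).Adj (Sum.inr false) (Sum.inl y) ↔ (y : W) ∈ N₁ := fun y => Iff.rfl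
  have h2 : ∀ y : {w : W // w ≠ v},
      (splitGraph G v N₁ N₂).Adj (Sum.inr true) (Sum.inl y) ↔ (y : W) ∈ N₂ := fun y => Iff.rfl
  have h3 : ∀ y, G.Adj v y ↔ y ∈ N₁ ∨ y ∈ N₂ := fun y => by
    rw [← SimpleGraph.mem_neighborSet, ← hN]; rfl
  have h4 : ∑ y : {y : W // ¬ y ≠ v}, (if G.Adj v y then 1 else 0) = 0 := by
    refine Finset.sum_eq_zero fun y _ => if_neg ?_
    rw [not_not.1 y.2]
    exact G.irrefl
  rw [degree_eq_sum, degree_eq_sum, degree_eq_sum, Fintype.sum_sum_type, Fintype.sum_sum_type,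
    Fintype.sum_bool, Fintype.sum_bool, ← Fintype.sum_subtype_add_sum_subtype (fun y => y ≠ v)
      (fun y => if G.Adj v y then 1 else 0), h4]
  have h5 : ∑ y : {w : W // w ≠ v}, (if G.Adj v y then 1 else 0) =
      ∑ y : {w : W // w ≠ v}, (if (y : W) ∈ N₁ then 1 else 0) +
        ∑ y : {w : W // w ≠ v}, (if (y : W) ∈ N₂ then 1 else 0) := by
    rw [← Finset.sum_add_distrib]
    refine Finset.sum_congr rfl fun y _ => ?_
    simp only [h3]
    by_cases hy : (y : W) ∈ N₁
    · simp [hy, hd.notMem_of_mem_left hy]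
    · simp [hy]
  rw [h5]
  simp only [hff, h1, h2]
  simp
  omega

-- Since the degrees of the two halves sum to Δ + 2, this lower bound keeps each of them at most Δ.
open Classical in
theorem two_le_degree_splitGraph_inr (hN : N₁ ∪ N₂ = G.neighborSet v) (hN₁ : N₁.Nonempty)
    (hN₂ : N₂.Nonempty) (i : Bool) : 2 ≤ (splitGraph G v N₁ N₂).degree (Sum.inr i) := by
  have hne : ∀ y, y ∈ N₁ ∨ y ∈ N₂ → y ≠ v := fun y hy => by
    have : G.Adj v y := by rw [← SimpleGraph.mem_neighborSet, ← hN]; exact hy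
    exact this.ne'
  obtain ⟨y, hy⟩ : ∃ y : {w : W // w ≠ v}, (splitGraph G v N₁ N₂).Adj (Sum.inr i) (Sum.inl y) := by
    cases i
    · obtain ⟨y, hy⟩ := hN₁
      exact ⟨⟨y, hne y (Or.inl hy)⟩, hy⟩
    · obtain ⟨y, hy⟩ := hN₂
      exact ⟨⟨y, hne y (Or.inr hy)⟩, hy⟩
  have hj : (splitGraph G v N₁ N₂).Adj (Sum.inr i) (Sum.inr (!i)) := by
    cases i <;> exact fun h => by simp at h
  rw [← SimpleGraph.card_neighborFinset_eq_degree]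
  refine Finset.one_lt_card.2 ⟨Sum.inl y, ?_, Sum.inr (!i), ?_, by simp⟩ <;> simpa

end Degree

end VertexSplitting

/-! ### The theorem -/

open VertexSplitting in
theorem theorem1 {W V : Type*} [Fintype W] [Fintype V]
    (n Δ : ℕ) (hn : 0 < n) (hΔ : 0 < Δ) (hbound : (2 * (n : ℚ) - 4) / 3 ≤ (Δ : ℚ))
    (G₀ : SimpleGraph W) [DecidableRel G₀.Adj] (hW : Fintype.card W = n - 1)
    (hconn : G₀.Connected) (hreg : G₀.IsRegularOfDegree Δ)
    (hclass : VertexSplitting.IsClassOne G₀)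
    (G : SimpleGraph V) [DecidableRel G.Adj] (hV : Fintype.card V = n)
    (hsplit : VertexSplitting.IsVertexSplitting G₀ G) :
    VertexSplitting.IsOverfull G ∧
    VertexSplitting.IsClassTwo G ∧
    (∀ e ∈ G.edgeSet, VertexSplitting.IsCriticalEdge G e) ∧
    VertexSplitting.IsDeltaCritical G Δ := by
  classical
  obtain ⟨v, N₁, N₂, hN₁, hN₂, hd, hN, ⟨φ⟩⟩ := hsplit
  have hne : Nonempty W := ⟨v⟩
  have hbound' : 2 * Fintype.card W ≤ 3 * Δ + 2 := by
    have h1 : (2 * (n : ℚ) - 4) ≤ 3 * Δ := by linarith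
    have h2 : 2 * n ≤ 3 * Δ + 4 := by
      have : (2 * (n : ℚ)) ≤ 3 * Δ + 4 := by linarith
      exact_mod_cast this
    omega
  have hcol : G₀.lineGraph.Colorable Δ := by
    rw [← chromaticIndex_le_iff, hclass, hreg.maxDegree_eq]
  obtain ⟨f, hf⟩ := exists_isPole_of_regular hreg hΔ hcol
  have : Nonempty (Fin Δ) := ⟨⟨0, hΔ⟩⟩
  have heven := hf.even_card
  have hinl : ∀ x, (splitGraph G₀ v N₁ N₂).degree (Sum.inl x) = Δ := fun x => by
    rw [degree_splitGraph_inl hN hd]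
    exact hreg x
  have hinr := degree_splitGraph_inr_add hN hd
  rw [show G₀.degree v = Δ by exact hreg v] at hinr
  have htwo := two_le_degree_splitGraph_inr hN hN₁ hN₂
  have hdeg : ∀ u, G.degree u = (splitGraph G₀ v N₁ N₂).degree (φ u) := fun u =>
    (φ.degree_eq u).symm
  have hle : ∀ p, (splitGraph G₀ v N₁ N₂).degree p ≤ Δ := by
    rintro (x | i)
    · exact (hinl x).le
    · have h1 := htwo false
      have h2 := htwo true
      cases i <;> omega
  obtain ⟨x₁, hx₁⟩ := hN₁
  have hx₁v : x₁ ≠ v := by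
    have : G₀.Adj v x₁ := by rw [← SimpleGraph.mem_neighborSet, ← hN]; exact Or.inl hx₁
    exact this.ne'
  have hmax : G.maxDegree = Δ := by
    apply le_antisymm
    · exact G.maxDegree_le_of_forall_degree_le Δ fun u => (hdeg u).trans_le (hle _)
    · have h1 := G.degree_le_maxDegree (φ.symm (Sum.inl ⟨x₁, hx₁v⟩))
      rwa [hdeg, RelIso.apply_symm_apply, hinl] at h1
  have hedges : 2 * G.edgeFinset.card = Δ * Fintype.card W + 2 := by
    rw [← SimpleGraph.sum_degrees_eq_twice_card_edges,
      Fintype.sum_congr _ (fun u => (splitGraph G₀ v N₁ N₂).degree (φ.toEquiv u)) hdeg,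
      Equiv.sum_comp φ.toEquiv (fun p => (splitGraph G₀ v N₁ N₂).degree p), Fintype.sum_sum_type,
      Fintype.sum_bool]
    have h1 : Fintype.card {w : W // w ≠ v} + 1 = Fintype.card W := by
      have h2 : Fintype.card {w : W // w ≠ v} = Fintype.card W - 1 := by simp
      have hpos := Fintype.card_pos (α := W)
      omega
    simp only [hinl, Finset.sum_const, Finset.card_univ, smul_eq_mul]
    rw [← h1, mul_add, mul_comm Δ]
    omega
  -- Since `Fintype.card W` is even, the extra vertex does not raise ⌊n/2⌋, while the new edge is
  -- one too many.
  have hover : IsOverfull G := by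
    unfold IsOverfull
    obtain ⟨r, hr⟩ := heven
    have h1 : Fintype.card V / 2 = r := by omega
    rw [hmax, h1]
    have h2 : Δ * Fintype.card W = 2 * (Δ * r) := by rw [hr]; ring
    omega
  have hnot : ¬ G.lineGraph.Colorable Δ := fun h => by
    have h1 := card_edgeFinset_le h
    unfold IsOverfull at hover
    rw [hmax] at hover
    omega
  have hidx : chromaticIndex G = (Δ : ℕ∞) + 1 := by
    apply le_antisymm
    · have h1 : G.lineGraph.Colorable (Δ + 1) :=
        colorable_lineGraph_of_copy φ.toCopy (splitGraph_colorable_succ hN hd hf)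
      exact_mod_cast chromaticIndex_le_iff.2 h1
    · rw [← not_le, ← chromaticIndex_le_iff] at *
      exact Order.add_one_le_of_lt (not_le.1 hnot)
  have hlt : ∀ {V' : Type _} (H : SimpleGraph V'), H.lineGraph.Colorable Δ →
      chromaticIndex H < chromaticIndex G := fun H hH => by
    rw [hidx]
    refine lt_of_le_of_lt (chromaticIndex_le_iff.2 hH) ?_
    exact_mod_cast Nat.lt_succ_self Δ
  have hdel : ∀ p q, (splitGraph G₀ v N₁ N₂).Adj p q →
      ((splitGraph G₀ v N₁ N₂).deleteEdges {s(p, q)}).lineGraph.Colorable Δ := by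
    rintro (w | i) (z | j) h
    · exact deleteEdges_colorable_of_hasSplitColoring hN hd
        (hasSplitColoring_of_regular hreg hbound' hN hd ⟨x₁, hx₁⟩ hN₂ hf h w.2 z.2)
    · rw [Sym2.eq_swap]
      exact deleteEdges_colorable_of_inr hN hd hf j h.symm (f v w) (by rintro y ⟨⟩; rfl)
    · exact deleteEdges_colorable_of_inr hN hd hf i h (f v z) (by rintro y ⟨⟩; rfl)
    -- Here the new edge itself is deleted, so the color reserved for it is arbitrary.
    · exact deleteEdges_colorable_of_inr hN hd hf i h ⟨0, hΔ⟩ (by rintro y ⟨⟩)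
  have hdelG : ∀ a b, G.Adj a b → (G.deleteEdges {s(a, b)}).lineGraph.Colorable Δ := by
    intro a b hab
    refine colorable_lineGraph_of_copy ⟨⟨φ, fun {p q} hpq => ?_⟩, φ.injective⟩
      (hdel (φ a) (φ b) (φ.map_adj_iff.2 hab))
    rw [SimpleGraph.deleteEdges_adj] at hpq ⊢
    refine ⟨φ.map_adj_iff.2 hpq.1, fun h => hpq.2 ?_⟩
    have h1 : Sym2.map φ s(p, q) = Sym2.map φ s(a, b) := h
    exact Sym2.map.injective φ.injective h1
  refine ⟨hover, ?_, ?_, hmax, ?_, hidx⟩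
  · intro h
    apply hnot
    rw [← chromaticIndex_le_iff, h, hmax]
  · intro e he
    refine ⟨he, ?_⟩
    induction e with
    | _ a b => exact hlt _ (hdelG a b he)
  · intro H hH
    -- No vertex is isolated, so a subgraph containing all edges is everything; any other one embeds
    -- in `G` minus an edge.
    by_cases hall : ∀ a b, G.Adj a b → H.Adj a b
    · exfalso
      apply hH
      have hverts : ∀ a, a ∈ H.verts := by
        intro a
        have hpos : 0 < G.degree a := by
          rw [hdeg]
          rcases h : φ a with x | i
          · rw [hinl]; exact hΔ
          · exact lt_of_lt_of_le two_pos (htwo i)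
        obtain ⟨b, hb⟩ := (G.degree_pos_iff_exists_adj a).1 hpos
        exact H.edge_vert (hall a b hb)
      apply SimpleGraph.Subgraph.ext
      · ext a; simp [hverts a]
      · ext a b
        exact ⟨fun h => H.adj_sub h, fun h => hall a b h⟩
    · push Not at hall
      obtain ⟨a, b, hab, hnab⟩ := hall
      refine hlt _ (colorable_lineGraph_of_copy ⟨⟨Subtype.val, fun {p q} hpq => ?_⟩,
        Subtype.val_injective⟩ (hdelG a b hab))
      rw [SimpleGraph.deleteEdges_adj]
      refine ⟨H.adj_sub hpq, fun h => hnab ?_⟩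
      rcases Sym2.eq_iff.1 h with ⟨h1, h2⟩ | ⟨h1, h2⟩
      · rw [← h1, ← h2]; exact hpq
      · rw [← h1, ← h2]; exact SimpleGraph.Subgraph.Adj.symm hpq
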